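/- Fix a first-order signature \(\mathcal F\), a set of variables \(\mathcal V\), and a set of nodes carrying a total order without greatest element. A TRS \(\mathcal R\) is a finite set of rules \(l\to r\) with \(l\notin\mathcal V\) and \(\mathrm{Var}(r)\subseteq\mathrm{Var}(l)\). We write \(s\to_{\mathcal R,p}t\) if \(s=C[l\sigma]\) and \(t=C[r\sigma]\) for some rule \(l\to r\) in \(\mathcal R\), substitution \(\sigma\) and one-hole context \(C\) whose hole is at position \(p\). A term graph \(S\) is a finite, acyclic, rooted graph whose nodes \(u\) carry a label in \(\mathcal F\cup\mathcal V\) and an ordered list of successors, such that a node labelled by a \(k\)-ary symbol has \(k\) successors, a node labelled by a variable has none, and every variable labels at most one node. \(\mathrm{term}(S)\) is the term obtained by unravelling \(S\) from its root. The positions of a node are the sequences of successor indices of the paths from the root to it; a node is unshared if it has exactly one position, and it is (strictly) above or below \(p\) if one of its positions is a (strict) prefix or extension of \(p\). \(S\) is minimally sharing if all its nodes other than variable nodes are unshared. \(G{\restriction}u\) is the subgraph of \(G\) reachable from \(u\). A morphism \(m\colon L\to S\) of term graphs maps nodes to nodes and root to root, and preserves labels and successor lists at all nodes with labels in \(\mathcal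 F\). A graph rewrite rule \(L\to R\) is a pair of term graphs which agree in labels and successors on their common nodes, such that the root of \(L\) is neither a variable node nor a node of \(R\), and all variable nodes of \(R\) are variable nodes of \(L\). For a set \(\mathcal G\) of graph rewrite rules, \(S\to_{\mathcal G,p}T\) means: for the node \(u\) of \(S\) at position \(p\), there are a rule \(L'\to R'\) isomorphic to one in \(\mathcal G\) and having no node in common with \(S\), and a morphism \(m\colon L'\to S{\restriction}u\), such that \(T\) is the term graph \(S[m(R')]_u\). Here \(m(R')\) is obtained from \(R'\) by replacing each node \(v\) of \(L'\) in it by the node \(m(v)\) of \(S\) (with its label and successors in \(S\)). The graph \(S[H]_u\) is obtained from \(S\) by deleting \(u\), redirecting all edges into \(u\) to the root of \(H\), forming the union with \(H\), and keeping only what is reachable from the new root (the root of \(H\) if \(u\) is the root of \(S\), and the root of \(S\) otherwise). A simulating graph rewrite system \(\mathcal G(\mathcal R)\) of \(\mathcal R\) contains for each rule \(l\to r\) of \(\mathcal R\) some graph rewrite rule \(L\to R\), where \(L\) and \(R\) are minimally sharing, \(\mathrm{term}(L)=l\), \(\mathrm{term}(R)=r\), and the common nodes of \(L\) and \(R\)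 are exactly the variable nodes of \(R\); and it contains only rules of this kind. For nodes \(u>v\) of \(S\), write \(S\sqsupset^u_v T\) if the map that sends \(u\) to \(v\) and fixes all other nodes of \(S\) maps the nodes of \(S\) to nodes of \(T\), maps root to root, and preserves labels and successor lists at all nodes. \(S\) folds strictly below \(p\) to \(T\), written \(S\sqsupset_p T\), if \(S\sqsupset^u_v T\) for some nodes \(u,v\) strictly below \(p\) in \(S\). \(S\) unfolds above \(p\) to \(T\), written \(S\lhd_p T\), if \(T\sqsupset^u_v S\) for some nodes \(u,v\) of \(T\) such that \(u\) is unshared in \(T\) and above \(p\), i.e. its only position in \(T\) is a prefix of \(p\). For a relation \(\rhd\), \(a\rhd^! b\) means that \(a\rhd^* b\) and there is no \(c\) with \(b\rhd c\). **Theorem (Adequacy).** Let \(\mathcal R\) be a TRS, \(\mathcal G(\mathcal R)\) a simulating graph rewrite system of \(\mathcal R\), \(s\) and \(t\) terms, \(S\) a term graph with \(\mathrm{term}(S)=s\), and \(p\) a position. Then \[ s\to_{\mathcal R,p}t \iff \text{there are term graphs } U,W,T \text{ with } S\lhd_p^!\,U\sqsupset_p^!\,W\to_{\mathcal G(\mathcal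 R),p}T \text{ and } \mathrm{term}(T)=t. \] -/

import Mathlib

open FirstOrder

namespace TGR

/-! ### Terms and term rewriting

A signature is given by the function symbols of a first-order language `L`: `L.Functions n` are the
symbols of arity `n` (relation symbols play no role), and `L.Term V` are the terms over `L` with
variables in `V`.  A position is a list of argument indices, counted from `0`. -/

/-- One-hole contexts. In `arg f ts i C` the `i`-th argument of `f` is the context `C`, the other
arguments are the terms `ts j`, `j ≠ i` (the value `ts i` is not used). -/
inductive Context (L : Language) (V : Type*) where
  | hole : Context L V
  | arg {n : ℕ} (f : L.Functions n) (ts : Fin n → L.Term V) (i : Fin n) (C : Context L V) :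
      Context L V

namespace Context

variable {L : Language} {V : Type*}

/-- `C[t]`: fill the hole of `C` with the term `t`. -/
def plug : Context L V → L.Term V → L.Term V
  | hole, t => t
  | arg f ts i C, t => Language.Term.func f (Function.update ts i (C.plug t))

/-- The position of the hole. -/
def holePos : Context L V → List ℕ
  | hole => []
  | arg _ _ i C => (i : ℕ) :: C.holePos

end Context

open Classical in
/-- A term rewrite system: a finite set of rules `l → r` such that `l` is not a variable and every
variable of `r` occurs in `l`. -/
structure TRS (L : Language) (V : Type*) where
  rules : Set (L.Term V × L.Term V)
  finite : rules.Finite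
  lhs_not_var : ∀ ρ ∈ rules, ∀ x : V, ρ.1 ≠ Language.Term.var x
  vars_subset : ∀ ρ ∈ rules, ρ.2.varFinset ⊆ ρ.1.varFinset

/-- `s` rewrites to `t` at position `p`. -/
def TRS.RewritesAt {L : Language} {V : Type*} (R : TRS L V) (p : List ℕ) (s t : L.Term V) : Prop :=
  ∃ ρ ∈ R.rules, ∃ (C : Context L V) (σ : V → L.Term V),
    C.holePos = p ∧ s = C.plug (ρ.1.subst σ) ∧ t = C.plug (ρ.2.subst σ)

/-! ### Labelled graphs with a root -/

/-- Node labels: function symbols (with their arity) or variables. -/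
abbrev Label (L : Language) (V : Type*) := (Σ n, L.Functions n) ⊕ V

/-- Raw data of a finite labelled ordered graph with a distinguished node. The values of `succ` and
`lab` outside of `nodes` are irrelevant. -/
structure LGraph (N Λ : Type*) where
  nodes : Finset N
  succ : N → List N
  lab : N → Λ
  root : N

namespace LGraph

variable {N Λ : Type*}

/-- `v` is one of the successors of the node `u`. -/
def Edge (G : LGraph N Λ) (u v : N) : Prop := u ∈ G.nodes ∧ v ∈ G.succ u

/-- `v` is reachable from `u`. -/
def Reach (G : LGraph N Λ) : N → N → Prop := Relation.ReflTransGen G.Edge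

/-- Following the successor indices `p` from `u` leads to `v`. -/
def Path (G : LGraph N Λ) : N → List ℕ → N → Prop
  | u, [], v => u = v
  | u, i :: p, v => ∃ w, (G.succ u)[i]? = some w ∧ G.Path w p v

/-- The set of positions of the node `u`; `u` corresponds to `p` if `p ∈ G.pos u`. -/
def pos (G : LGraph N Λ) (u : N) : Set (List ℕ) := {p | G.Path G.root p u}

/-- A node is unshared if it has exactly one position. -/
def Unshared (G : LGraph N Λ) (u : N) : Prop := ∃ q, G.pos u = {q}

open Classical in
/-- The subgraph of `G` of all nodes reachable from `u`, rooted at `u`. -/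
noncomputable def subgraphAt (G : LGraph N Λ) (u : N) : LGraph N Λ where
  nodes := {w ∈ G.nodes | G.Reach u w}
  succ := G.succ
  lab := G.lab
  root := u

theorem mem_nodes_subgraphAt (G : LGraph N Λ) (u w : N) :
    w ∈ (G.subgraphAt u).nodes ↔ w ∈ G.nodes ∧ G.Reach u w := by
  classical
  simp [subgraphAt]

/-- `G` and `H` are the same rooted graph (irrelevant values are ignored). -/
def Same (G H : LGraph N Λ) : Prop :=
  G.nodes = H.nodes ∧ G.root = H.root ∧
    ∀ u ∈ G.nodes, G.lab u = H.lab u ∧ G.succ u = H.succ u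

/-- `G` and `H` are properly sharing: common nodes have equal labels and equal successors. -/
def ProperlySharing (G H : LGraph N Λ) : Prop :=
  ∀ u ∈ G.nodes, u ∈ H.nodes → G.lab u = H.lab u ∧ G.succ u = H.succ u

/-- `G ≥ₘ H`: `m` maps the root to the root and preserves labels and successors at all nodes. -/
def Collapses (m : N → N) (G H : LGraph N Λ) : Prop :=
  Set.MapsTo m G.nodes H.nodes ∧ m G.root = H.root ∧
    ∀ u ∈ G.nodes, H.lab (m u) = G.lab u ∧ H.succ (m u) = (G.succ u).map m

/-- `m` is an isomorphism from `G` to `H`. -/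
def IsIso (m : N → N) (G H : LGraph N Λ) : Prop :=
  G.Collapses m H ∧ Set.BijOn m G.nodes H.nodes

section Replace

variable [DecidableEq N]

/-- Redirection of the node `u` to the node `v`: `u` is removed, and all edges into `u` now lead to
`v`. -/
def redirect (G : LGraph N Λ) (u v : N) : LGraph N Λ where
  nodes := (insert v G.nodes).erase u
  succ := fun w => (G.succ w).map (Function.update id u v)
  lab := G.lab
  root := Function.update id u v G.root

/-- Union of graphs, rooted at `r`. On common nodes the values of `H` are used; for properly sharing
graphs both graphs have the same values there. -/
def unionAt (G H : LGraph N Λ) (r : N) : LGraph N Λ where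
  nodes := G.nodes ∪ H.nodes
  succ := fun w => if w ∈ H.nodes then H.succ w else G.succ w
  lab := fun w => if w ∈ H.nodes then H.lab w else G.lab w
  root := r

/-- `G[H]ᵤ`: replace the subgraph of `G` at `u` by `H`, and keep what is reachable from the root
(which is the root of `H` if `u` is the root of `G`, and the root of `G` otherwise). -/
noncomputable def replaceAt (G : LGraph N Λ) (u : N) (H : LGraph N Λ) : LGraph N Λ :=
  let r := if u = G.root then H.root else G.root
  ((G.redirect u H.root).unionAt H r).subgraphAt r

end Replace

end LGraph

/-! ### Term graphs -/

/-- Term graphs: acyclic rooted graphs over function symbols and variables such that function nodes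
have as many successors as the arity says, variable nodes have no successors, and each variable
labels at most one node. -/
structure TermGraph (L : Language) (V N : Type*) extends LGraph N (Label L V) where
  root_mem : root ∈ nodes
  succ_mem : ∀ u ∈ nodes, ∀ v ∈ succ u, v ∈ nodes
  acyclic : ∀ u, ¬ Relation.TransGen toLGraph.Edge u u
  rooted : ∀ u ∈ nodes, toLGraph.Reach root u
  arity : ∀ u ∈ nodes, ∀ (n : ℕ) (f : L.Functions n), lab u = Sum.inl ⟨n, f⟩ → (succ u).length = n
  var_succ : ∀ u ∈ nodes, ∀ x : V, lab u = Sum.inr x → succ u = []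
  var_shared : ∀ u ∈ nodes, ∀ v ∈ nodes, ∀ x : V, lab u = Sum.inr x → lab v = Sum.inr x → u = v

namespace TermGraph

variable {L : Language} {V N : Type*}

/-- `S.Represents u t`: the subgraph of `S` at the node `u` represents the term `t`. -/
inductive Represents (S : TermGraph L V N) : N → L.Term V → Prop where
  | var (u : N) (x : V) (hu : u ∈ S.nodes) (hl : S.lab u = Sum.inr x) :
      Represents S u (Language.Term.var x)
  | func (u : N) {n : ℕ} (f : L.Functions n) (vs : Fin n → N) (ts : Fin n → L.Term V)
      (hu : u ∈ S.nodes) (hl : S.lab u = Sum.inl ⟨n, f⟩) (hs : S.succ u = List.ofFn vs)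
      (h : ∀ i, Represents S (vs i) (ts i)) : Represents S u (Language.Term.func f ts)

theorem Represents.unique {S : TermGraph L V N} {u : N} {s t : L.Term V}
    (hs : S.Represents u s) (ht : S.Represents u t) : s = t := by
  induction hs generalizing t with
  | var u x hu hl =>
    cases ht with
    | var _ y _ hl' => rw [hl] at hl'; cases hl'; rfl
    | func _ f vs ts _ hl' _ _ => rw [hl] at hl'; cases hl'
  | func u f vs ts hu hl hs _ ih =>
    cases ht with
    | var _ y _ hl' => rw [hl] at hl'; cases hl'
    | func _ f' vs' ts' _ hl' hs' h' =>
      rw [hl] at hl'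
      cases hl'
      have hv : vs = vs' := List.ofFn_injective (hs.symm.trans hs')
      subst hv
      congr 1
      funext i
      exact ih i (h' i)

theorem exists_represents (S : TermGraph L V N) (u : N) (hu : u ∈ S.nodes) :
    ∃ t, S.Represents u t := by
  let r : {u // u ∈ S.nodes} → {u // u ∈ S.nodes} → Prop :=
    fun a b => Relation.TransGen S.Edge b.1 a.1
  have : Std.Irrefl r := ⟨fun a h => S.acyclic a.1 h⟩
  have : IsTrans _ r := ⟨fun a b c h₁ h₂ => h₂.trans h₁⟩
  have wf : WellFounded r := Finite.wellFounded_of_trans_of_irrefl r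
  suffices H : ∀ a : {u // u ∈ S.nodes}, ∃ t, S.Represents a.1 t from H ⟨u, hu⟩
  intro a
  induction a using wf.induction with
  | _ a ih =>
    obtain ⟨u, hu⟩ := a
    rcases hl : S.lab u with ⟨n, f⟩ | x
    · have hn := S.arity u hu n f hl
      have key : ∀ i : Fin (S.succ u).length, ∃ t, S.Represents ((S.succ u).get i) t := by
        intro i
        have hm := List.get_mem (S.succ u) i
        exact ih ⟨_, S.succ_mem u hu _ hm⟩ (Relation.TransGen.single ⟨hu, hm⟩)
      subst hn
      choose ts hts using key
      exact ⟨_, Represents.func u f _ ts hu hl (List.ofFn_get _).symm hts⟩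
    · exact ⟨_, Represents.var u x hu hl⟩

/-- The term represented by a term graph. -/
noncomputable def term (S : TermGraph L V N) : L.Term V :=
  (S.exists_represents S.root S.root_mem).choose

theorem represents_iff_term_eq (S : TermGraph L V N) (t : L.Term V) :
    S.Represents S.root t ↔ S.term = t := by
  have h := (S.exists_represents S.root S.root_mem).choose_spec
  exact ⟨fun ht => h.unique ht, fun e => e ▸ h⟩

/-- The set of variable nodes of `S`. -/
def varNodes (S : TermGraph L V N) : Set N := {u | u ∈ S.nodes ∧ ∃ x : V, S.lab u = Sum.inr x}

/-- All nodes except variable nodes are unshared. -/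
def MinimallySharing (S : TermGraph L V N) : Prop :=
  ∀ u ∈ S.nodes, u ∈ S.varNodes ∨ S.Unshared u

/-- The minimally sharing term graphs that represent `s`. -/
def tree (N : Type*) (s : L.Term V) : Set (TermGraph L V N) :=
  {S | S.MinimallySharing ∧ S.term = s}

/-- `m` is a morphism from the term graph `S` to `G`: it maps the root to the root, and preserves
labels and successors at all nodes that are labelled by function symbols. -/
def IsMorphism (m : N → N) (S : TermGraph L V N) (G : LGraph N (Label L V)) : Prop :=
  Set.MapsTo m S.nodes G.nodes ∧ m S.root = G.root ∧
    ∀ u ∈ S.nodes, u ∉ S.varNodes → G.lab (m u) = S.lab u ∧ G.succ (m u) = (S.succ u).map m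

end TermGraph

/-! ### Graph rewriting -/

/-- Graph rewrite rules. -/
structure GraphRule (L : Language) (V N : Type*) where
  lhs : TermGraph L V N
  rhs : TermGraph L V N
  sharing : lhs.ProperlySharing rhs.toLGraph
  lhs_root_not_var : lhs.root ∉ lhs.varNodes
  vars_subset : rhs.varNodes ⊆ lhs.varNodes
  lhs_root_not_mem : lhs.root ∉ rhs.nodes

namespace GraphRule

variable {L : Language} {V N : Type*}

/-- The two rules are isomorphic: one bijection of the nodes of the rules maps left-hand side to
left-hand side and right-hand side to right-hand side. -/
def Isomorphic (ρ ρ' : GraphRule L V N) : Prop :=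
  ∃ φ : N → N, Set.InjOn φ {u | u ∈ ρ.lhs.nodes ∨ u ∈ ρ.rhs.nodes} ∧
    ρ.lhs.IsIso φ ρ'.lhs.toLGraph ∧ ρ.rhs.IsIso φ ρ'.rhs.toLGraph

/-- `ρ'` is a renaming of `ρ` with respect to `S`: isomorphic to `ρ`, and without nodes of `S`. -/
def IsRenaming (ρ' ρ : GraphRule L V N) (S : TermGraph L V N) : Prop :=
  ρ'.Isomorphic ρ ∧ Disjoint S.nodes ρ'.lhs.nodes ∧ Disjoint S.nodes ρ'.rhs.nodes

/-- `m(R)` for a rule `L → R` without nodes of `S` and a morphism `m` from `L` into `S`: every node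
`v` of `R` that is also a node of `L` is replaced by the node `m v` of `S`, which keeps its label and
its successors in `S`. -/
def imageRhs [DecidableEq N] (ρ : GraphRule L V N) (m : N → N) (S : TermGraph L V N) :
    LGraph N (Label L V) :=
  let m' : N → N := fun v => if v ∈ ρ.lhs.nodes then m v else v
  { nodes := ρ.rhs.nodes.image m'
    succ := fun w => if w ∈ S.nodes then S.succ w else (ρ.rhs.succ w).map m'
    lab := fun w => if w ∈ S.nodes then S.lab w else ρ.rhs.lab w
    root := m' ρ.rhs.root }

end GraphRule

variable {L : Language} {V N : Type*}

/-- `S` rewrites to `T` at the node `u` in the graph rewrite system `G`. -/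
def GraphRewritesAtNode [DecidableEq N] (G : Set (GraphRule L V N)) (u : N)
    (S T : TermGraph L V N) : Prop :=
  u ∈ S.nodes ∧ ∃ ρ ∈ G, ∃ ρ' : GraphRule L V N, ρ'.IsRenaming ρ S ∧
    ∃ m : N → N, ρ'.lhs.IsMorphism m (S.subgraphAt u) ∧
      T.Same (S.replaceAt u (ρ'.imageRhs m S))

/-- `S` rewrites to `T` at the position `p` in the graph rewrite system `G`. -/
def GraphRewritesAt [DecidableEq N] (G : Set (GraphRule L V N)) (p : List ℕ)
    (S T : TermGraph L V N) : Prop :=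
  ∃ u, p ∈ S.pos u ∧ GraphRewritesAtNode G u S T

/-- The graph rewrite rule `ρ` simulates the rewrite rule `l → r`. -/
def Simulates (ρ : GraphRule L V N) (l r : L.Term V) : Prop :=
  ρ.lhs ∈ TermGraph.tree N l ∧ ρ.rhs ∈ TermGraph.tree N r ∧
    {u | u ∈ ρ.lhs.nodes ∧ u ∈ ρ.rhs.nodes} = ρ.rhs.varNodes

/-- `G` is a simulating graph rewrite system of `R`: it contains for each rule of `R` some
simulating graph rewrite rule, and no other rules. -/
def IsSimulatingGRS (R : TRS L V) (G : Set (GraphRule L V N)) : Prop :=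
  (∀ ρ ∈ R.rules, ∃ γ ∈ G, Simulates γ ρ.1 ρ.2) ∧ (∀ γ ∈ G, ∃ ρ ∈ R.rules, Simulates γ ρ.1 ρ.2)

/-! ### Folding and unfolding -/

section Fold

variable [LinearOrder N]

/-- Single-step folding: `T` arises from `S` by identifying the node `u` with the smaller node `v`,
that is, `S ≥ₘ T` for the map `m` with `m u = v` and `m w = w` for all other `w`. -/
def Fold (u v : N) (S T : TermGraph L V N) : Prop :=
  u ∈ S.nodes ∧ v ∈ S.nodes ∧ v < u ∧ S.Collapses (Function.update id u v) T.toLGraph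

/-- The node `u` is strictly below the position `p` in `S`. -/
def StrictlyBelow (S : TermGraph L V N) (p : List ℕ) (u : N) : Prop :=
  ∃ q ∈ S.pos u, p <+: q ∧ p ≠ q

/-- `S` folds strictly below `p` to `T` (in one step). -/
def FoldsBelow (p : List ℕ) (S T : TermGraph L V N) : Prop :=
  ∃ u v, StrictlyBelow S p u ∧ StrictlyBelow S p v ∧ Fold u v S T

/-- `S` unfolds above `p` to `T` (in one step): `T` folds to `S` by identifying a node `u` with a
smaller node `v`, where `u` is an unshared node of `T` above `p`. -/
def UnfoldsAbove (p : List ℕ) (S T : TermGraph L V N) : Prop :=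
  ∃ u v, Fold u v T S ∧ ∃ q, T.pos u = {q} ∧ q <+: p

end Fold

/-- `b` is a normal form of `a` with respect to the relation `r`. -/
def NormalFormOf {α : Type*} (r : α → α → Prop) (a b : α) : Prop :=
  Relation.ReflTransGen r a b ∧ ∀ c, ¬ r b c

end TGR

/-! A graph step at a node acts on all positions of that node at once, so it mirrors a single term
step at `p` once the node at `p` is unshared. A left-hand side that repeats a variable matches only
if the corresponding equal subterms are one node. Unfolding above `p` secures the first condition,
folding strictly below `p` the second, and neither changes the represented term, because collapses
preserve it.

Unfolding: if `p` carries a function symbol, so does every node on the path to it, and these nodes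
can be copied one after the other from the root downwards (`exists_unfolding`). A normal form
therefore has `p` unshared, and conversely a graph with `p` unshared is normal
(`not_unfoldsAbove_of_pos_eq`). Variable nodes cannot be copied, hence the condition `FunctionAt`; a
term step and a graph step at `p` both force it, as left-hand sides are not variables.

Folding: each step loses a node, so normal forms exist, and in them equal terms strictly below `p`
sit at the same node (`eq_of_rep_of_forall_not_foldsBelow`). Sending each node of the minimally
sharing left-hand side to the node at the same relative position is then a well-defined morphism
(`exists_isMorphism`).

The term of the replaced graph is computed in `IsMatch.rep_replaceAt`: acyclicity protects the part
below the redex node `u`, and unsharedness protects the part beside the path to `u`. The graphs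
built on the way are not yet known to be term graphs, so the relation `Rep` is defined for raw
graphs. -/

namespace TGR

namespace LGraph

variable {N Λ : Type*}

/-- All successors of nodes are nodes. -/
def Closed (G : LGraph N Λ) : Prop := ∀ u ∈ G.nodes, ∀ v ∈ G.succ u, v ∈ G.nodes

/-! ### Paths and their behaviour under collapses -/

section Paths

variable {G : LGraph N Λ}

theorem path_append {u w : N} {p q : List ℕ} :
    G.Path u (p ++ q) w ↔ ∃ v, G.Path u p v ∧ G.Path v q w := by
  induction p generalizing u with
  | nil => simp [Path]
  | cons i p ih =>
    simp only [List.cons_append, Path, ih]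
    constructor
    · rintro ⟨x, hx, v, h₁, h₂⟩
      exact ⟨v, ⟨x, hx, h₁⟩, h₂⟩
    · rintro ⟨v, ⟨x, hx, h₁⟩, h₂⟩
      exact ⟨x, hx, v, h₁, h₂⟩

theorem path_concat {u w : N} {p : List ℕ} {i : ℕ} :
    G.Path u (p ++ [i]) w ↔ ∃ v, G.Path u p v ∧ (G.succ v)[i]? = some w := by
  rw [path_append]
  simp [Path]

theorem Path.unique {u v w : N} {p : List ℕ} (h₁ : G.Path u p v) (h₂ : G.Path u p w) : v = w := by
  induction p generalizing u with
  | nil => exact h₁.symm.trans h₂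
  | cons i p ih =>
    obtain ⟨x, hx, h₁⟩ := h₁
    obtain ⟨y, hy, h₂⟩ := h₂
    cases Option.some.inj (hx.symm.trans hy)
    exact ih h₁ h₂

theorem Path.mem (hG : G.Closed) {u v : N} {p : List ℕ} (hu : u ∈ G.nodes) (h : G.Path u p v) :
    v ∈ G.nodes := by
  induction p generalizing u with
  | nil => exact h ▸ hu
  | cons i p ih =>
    obtain ⟨x, hx, h⟩ := h
    exact ih (hG u hu x (List.mem_of_getElem? hx)) h

theorem Path.reach (hG : G.Closed) {u v : N} {p : List ℕ} (hu : u ∈ G.nodes) (h : G.Path u p v) :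
    G.Reach u v := by
  induction p generalizing u with
  | nil => exact h ▸ Relation.ReflTransGen.refl
  | cons i p ih =>
    obtain ⟨x, hx, h⟩ := h
    have hx' := List.mem_of_getElem? hx
    exact (ih (hG u hu x hx') h).head ⟨hu, hx'⟩

theorem Path.transGen (hG : G.Closed) {u v : N} {p : List ℕ} (hu : u ∈ G.nodes)
    (h : G.Path u p v) (hp : p ≠ []) : Relation.TransGen G.Edge u v := by
  cases p with
  | nil => exact absurd rfl hp
  | cons i p =>
    obtain ⟨x, hx, h⟩ := h
    have hx' := List.mem_of_getElem? hx
    exact Relation.TransGen.head' ⟨hu, hx'⟩ (h.reach hG (hG u hu x hx'))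

theorem Reach.exists_path {u v : N} (h : G.Reach u v) : ∃ p, G.Path u p v := by
  induction h with
  | refl => exact ⟨[], rfl⟩
  | tail _ e ih =>
    obtain ⟨p, hp⟩ := ih
    obtain ⟨i, hi⟩ := List.mem_iff_getElem?.1 e.2
    exact ⟨p ++ [i], path_concat.2 ⟨_, hp, hi⟩⟩

end Paths

namespace Collapses

variable {G H : LGraph N Λ} {m : N → N}

theorem path (h : G.Collapses m H) (hG : G.Closed) {u v : N} {p : List ℕ} (hu : u ∈ G.nodes)
    (hp : G.Path u p v) : H.Path (m u) p (m v) := by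
  induction p generalizing u with
  | nil => exact congrArg m hp
  | cons i p ih =>
    obtain ⟨x, hx, hp⟩ := hp
    refine ⟨m x, ?_, ih (hG u hu x (List.mem_of_getElem? hx)) hp⟩
    rw [(h.2.2 u hu).2, List.getElem?_map, hx, Option.map_some]

/-- A collapse acts entrywise on successor lists, so each edge index available at the image is
available at the source. -/
theorem lift_path (h : G.Collapses m H) (hG : G.Closed) {u w : N} {p : List ℕ}
    (hu : u ∈ G.nodes) (hp : H.Path (m u) p w) : ∃ v ∈ G.nodes, G.Path u p v ∧ m v = w := by
  induction p generalizing u with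
  | nil => exact ⟨u, hu, rfl, hp⟩
  | cons i p ih =>
    obtain ⟨x, hx, hp⟩ := hp
    rw [(h.2.2 u hu).2, List.getElem?_map, Option.map_eq_some_iff] at hx
    obtain ⟨y, hy, rfl⟩ := hx
    obtain ⟨v, hv, hyv, e⟩ := ih (hG u hu y (List.mem_of_getElem? hy)) hp
    exact ⟨v, hv, ⟨y, hy, hyv⟩, e⟩

end Collapses

/-! ### Terms represented by nodes of raw graphs -/

variable {L : Language} {V : Type*}

/-- The subgraph of `G` at the given node is the unravelling of the given term. -/
inductive Rep (G : LGraph N (Label L V)) : N → L.Term V → Prop where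
  | var (u : N) (x : V) (hu : u ∈ G.nodes) (hl : G.lab u = Sum.inr x) :
      Rep G u (Language.Term.var x)
  | func (u : N) {n : ℕ} (f : L.Functions n) (vs : Fin n → N) (ts : Fin n → L.Term V)
      (hu : u ∈ G.nodes) (hl : G.lab u = Sum.inl ⟨n, f⟩) (hs : G.succ u = List.ofFn vs)
      (h : ∀ i, Rep G (vs i) (ts i)) : Rep G u (Language.Term.func f ts)

namespace Rep

variable {G H : LGraph N (Label L V)}

theorem mem {u : N} {t : L.Term V} (h : G.Rep u t) : u ∈ G.nodes := by
  cases h <;> assumption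

theorem func_inv {u : N} {n : ℕ} {f : L.Functions n} {ts : Fin n → L.Term V}
    (h : G.Rep u (Language.Term.func f ts)) :
    ∃ vs : Fin n → N, G.lab u = Sum.inl ⟨n, f⟩ ∧ G.succ u = List.ofFn vs ∧
      ∀ i, G.Rep (vs i) (ts i) := by
  cases h with
  | func _ _ vs _ _ hl hs h => exact ⟨vs, hl, hs, h⟩

theorem var_inv {u : N} {x : V} (h : G.Rep u (Language.Term.var x)) : G.lab u = Sum.inr x := by
  cases h with
  | var _ _ _ hl => exact hl

/-- Terms are finite, so no infinite path starts at a node that represents one. This yields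
acyclicity in `TermGraph.ofRep`. -/
theorem acc {u : N} {t : L.Term V} (h : G.Rep u t) (hvar : ∀ u ∈ G.nodes, ∀ x : V,
    G.lab u = Sum.inr x → G.succ u = []) : Acc (fun b a => G.Edge a b) u := by
  induction h with
  | var u x hu hl =>
    refine ⟨_, fun y hy => ?_⟩
    have := hy.2
    simp [hvar u hu x hl] at this
  | func u f vs ts hu hl hs h ih =>
    refine ⟨_, fun y hy => ?_⟩
    have := hy.2
    rw [hs, List.mem_ofFn] at this
    obtain ⟨i, rfl⟩ := this
    exact ih i

theorem same {u : N} {t : L.Term V} (h : G.Rep u t) (hGH : H.Same G) : H.Rep u t := by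
  induction h with
  | var u x hu hl =>
    have hu' : u ∈ H.nodes := hGH.1 ▸ hu
    exact .var u x hu' ((hGH.2.2 u hu').1.trans hl)
  | func u f vs ts hu hl hs h ih =>
    have hu' : u ∈ H.nodes := hGH.1 ▸ hu
    exact .func u f vs ts hu' ((hGH.2.2 u hu').1.trans hl) ((hGH.2.2 u hu').2.trans hs) ih

theorem subgraphAt {r u : N} {t : L.Term V} (h : G.Rep u t) (hr : G.Reach r u) :
    (G.subgraphAt r).Rep u t := by
  induction h with
  | var u x hu hl => exact .var u x ((G.mem_nodes_subgraphAt r u).2 ⟨hu, hr⟩) hl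
  | func u f vs ts hu hl hs h ih =>
    refine .func u f vs ts ((G.mem_nodes_subgraphAt r u).2 ⟨hu, hr⟩) hl hs fun i => ih i ?_
    exact hr.tail ⟨hu, by rw [hs, List.mem_ofFn]; exact ⟨i, rfl⟩⟩

end Rep

namespace Collapses

variable {G H : LGraph N (Label L V)} {m : N → N}

theorem rep (h : G.Collapses m H) {u : N} {t : L.Term V} (hu : G.Rep u t) : H.Rep (m u) t := by
  induction hu with
  | var u x hu hl => exact .var _ x (h.1 hu) ((h.2.2 u hu).1.trans hl)
  | func u f vs ts hu hl hs _ ih =>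
    refine .func _ f (m ∘ vs) ts (h.1 hu) ((h.2.2 u hu).1.trans hl) ?_ ih
    rw [(h.2.2 u hu).2, hs, List.map_ofFn]

theorem rep_of_image (h : G.Collapses m H) (hG : G.Closed) {u : N} {t : L.Term V}
    (hu : u ∈ G.nodes) (ht : H.Rep (m u) t) : G.Rep u t := by
  induction t generalizing u with
  | var x => exact .var u x hu ((h.2.2 u hu).1.symm.trans ht.var_inv)
  | func f ts ih =>
    obtain ⟨vs, hl, hs, hv⟩ := ht.func_inv
    rw [(h.2.2 u hu).2] at hs
    have hlen := congrArg List.length hs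
    rw [List.length_map, List.length_ofFn] at hlen
    subst hlen
    have hs' : ∀ i, m ((G.succ u).get i) = vs i := fun i => by
      have := congrArg (fun l => l[(i : ℕ)]?) hs
      simpa using this
    refine .func u f (G.succ u).get ts hu ((h.2.2 u hu).1.symm.trans hl)
      (List.ofFn_get _).symm fun i => ih i (hG u hu _ (List.get_mem _ i)) ?_
    rw [hs' i]
    exact hv i

end Collapses

end LGraph

/-! ### Term graphs built from raw graphs -/

namespace TermGraph

variable {L : Language} {V N : Type*}

theorem closed (S : TermGraph L V N) : S.Closed := S.succ_mem

theorem represents_iff_rep {S : TermGraph L V N} {u : N} {t : L.Term V} :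
    S.Represents u t ↔ S.Rep u t := by
  constructor
  · intro h
    induction h with
    | var u x hu hl => exact .var u x hu hl
    | func u f vs ts hu hl hs _ ih => exact .func u f vs ts hu hl hs ih
  · intro h
    induction h with
    | var u x hu hl => exact .var u x hu hl
    | func u f vs ts hu hl hs _ ih => exact .func u f vs ts hu hl hs ih

theorem rep_root_iff {S : TermGraph L V N} {t : L.Term V} : S.Rep S.root t ↔ S.term = t := by
  rw [← represents_iff_rep, represents_iff_term_eq]

theorem rep_unique {S : TermGraph L V N} {u : N} {s t : L.Term V} (hs : S.Rep u s)
    (ht : S.Rep u t) : s = t :=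
  (represents_iff_rep.2 hs).unique (represents_iff_rep.2 ht)

theorem exists_rep (S : TermGraph L V N) {u : N} (hu : u ∈ S.nodes) : ∃ t, S.Rep u t := by
  obtain ⟨t, ht⟩ := S.exists_represents u hu
  exact ⟨t, represents_iff_rep.1 ht⟩

theorem exists_pos (S : TermGraph L V N) {u : N} (hu : u ∈ S.nodes) : ∃ q, q ∈ S.pos u :=
  (S.rooted u hu).exists_path

theorem mem_of_pos (S : TermGraph L V N) {u : N} {q : List ℕ} (hq : q ∈ S.pos u) : u ∈ S.nodes :=
  LGraph.Path.mem S.closed S.root_mem hq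

theorem path_self (S : TermGraph L V N) {u : N} {q : List ℕ} (hu : u ∈ S.nodes)
    (hq : S.Path u q u) : q = [] := by
  by_contra h
  exact S.acyclic u (hq.transGen S.closed hu h)

/-- A graph all whose nodes represent terms is a term graph if all nodes are reachable from the root
and variables are shared. -/
def ofRep (G : LGraph N (Label L V)) (hroot : G.root ∈ G.nodes)
    (hrep : ∀ u ∈ G.nodes, ∃ t, G.Rep u t)
    (hvar : ∀ u ∈ G.nodes, ∀ x : V, G.lab u = Sum.inr x → G.succ u = [])
    (hreach : ∀ u ∈ G.nodes, G.Reach G.root u)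
    (hshared : ∀ u ∈ G.nodes, ∀ v ∈ G.nodes, ∀ x : V,
      G.lab u = Sum.inr x → G.lab v = Sum.inr x → u = v) : TermGraph L V N where
  toLGraph := G
  root_mem := hroot
  succ_mem := by
    intro u hu v hv
    obtain ⟨t, ht⟩ := hrep u hu
    cases ht with
    | var _ x _ hl => simp [hvar u hu x hl] at hv
    | func _ f vs ts _ hl hs h =>
      rw [hs, List.mem_ofFn] at hv
      obtain ⟨i, rfl⟩ := hv
      exact (h i).mem
  acyclic := by
    intro u h
    have hu : u ∈ G.nodes := by
      obtain ⟨w, hw, -⟩ := Relation.TransGen.head'_iff.1 h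
      exact hw.1
    obtain ⟨t, ht⟩ := hrep u hu
    have hacc := (ht.acc hvar).transGen
    have : ∀ a, Acc (Relation.TransGen fun b a => G.Edge a b) a →
        ¬ Relation.TransGen (fun b a => G.Edge a b) a a := by
      intro a ha
      induction ha with
      | intro a _ ih => exact fun h => ih a h h
    exact this u hacc (Relation.transGen_swap.1 h)
  rooted := hreach
  arity := by
    intro u hu n f hf
    obtain ⟨t, ht⟩ := hrep u hu
    cases ht with
    | var _ x _ hl => rw [hl] at hf; cases hf
    | func _ f vs ts _ hl hs h =>
      rw [hl] at hf
      cases hf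
      rw [hs, List.length_ofFn]
  var_succ := hvar
  var_shared := hshared

/-- The image of a term graph under a map that preserves labels and successors. -/
def ofCollapses (S : TermGraph L V N) (m : N → N) (H : LGraph N (Label L V))
    (h : S.Collapses m H) (hsurj : ∀ y ∈ H.nodes, ∃ x ∈ S.nodes, m x = y) : TermGraph L V N :=
  ofRep H (h.2.1 ▸ h.1 S.root_mem)
    (by
      intro y hy
      obtain ⟨x, hx, rfl⟩ := hsurj y hy
      obtain ⟨t, ht⟩ := S.exists_rep hx
      exact ⟨t, h.rep ht⟩)
    (by
      intro y hy z hz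
      obtain ⟨x, hx, rfl⟩ := hsurj y hy
      rw [(h.2.2 x hx).1] at hz
      rw [(h.2.2 x hx).2, S.var_succ x hx z hz, List.map_nil])
    (by
      intro y hy
      obtain ⟨x, hx, rfl⟩ := hsurj y hy
      rw [← h.2.1]
      refine Relation.ReflTransGen.lift m (r := S.Edge) ?_ _ _ (S.rooted x hx)
      intro a b hab
      refine ⟨h.1 hab.1, ?_⟩
      rw [(h.2.2 a hab.1).2]
      exact List.mem_map_of_mem hab.2)
    (by
      intro y hy y' hy' z hz hz'
      obtain ⟨x, hx, rfl⟩ := hsurj y hy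
      obtain ⟨x', hx', rfl⟩ := hsurj y' hy'
      rw [(h.2.2 x hx).1] at hz
      rw [(h.2.2 x' hx').1] at hz'
      rw [S.var_shared x hx x' hx' z hz hz'])

section Collapses

variable {S T : TermGraph L V N} {m : N → N}

theorem pos_subset_of_collapses (h : S.Collapses m T.toLGraph) (u : N) :
    S.pos u ⊆ T.pos (m u) := by
  intro q hq
  have := h.path S.closed S.root_mem hq
  rwa [h.2.1] at this

theorem exists_pos_of_collapses (h : S.Collapses m T.toLGraph) {y : N} {q : List ℕ}
    (hq : q ∈ T.pos y) : ∃ x ∈ S.nodes, q ∈ S.pos x ∧ m x = y := by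
  have hq' : T.Path (m S.root) q y := by rw [h.2.1]; exact hq
  exact h.lift_path S.closed S.root_mem hq'

theorem surj_of_collapses (h : S.Collapses m T.toLGraph) {y : N} (hy : y ∈ T.nodes) :
    ∃ x ∈ S.nodes, m x = y := by
  obtain ⟨q, hq⟩ := T.exists_pos hy
  obtain ⟨x, hx, -, e⟩ := exists_pos_of_collapses h hq
  exact ⟨x, hx, e⟩

theorem term_eq_of_collapses (h : S.Collapses m T.toLGraph) : T.term = S.term := by
  rw [← rep_root_iff, ← h.2.1]
  exact h.rep (rep_root_iff.2 rfl)

end Collapses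

end TermGraph

end TGR

/-! ### Folding and unfolding -/

namespace TGR

variable {L : Language} {V N : Type*}

namespace TermGraph

/-- Some node of `S` at the position `p` is labelled by a function symbol. -/
def FunctionAt (S : TermGraph L V N) (p : List ℕ) : Prop :=
  ∃ u, p ∈ S.pos u ∧ ∃ f, S.lab u = Sum.inl f

theorem functionAt_iff_of_collapses {S T : TermGraph L V N} {m : N → N}
    (h : S.Collapses m T.toLGraph) (p : List ℕ) : S.FunctionAt p ↔ T.FunctionAt p := by
  constructor
  · rintro ⟨u, hu, f, hf⟩
    exact ⟨m u, pos_subset_of_collapses h u hu, f, (h.2.2 u (S.mem_of_pos hu)).1.trans hf⟩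
  · rintro ⟨u, hu, f, hf⟩
    obtain ⟨x, hx, hxp, rfl⟩ := exists_pos_of_collapses h hu
    exact ⟨x, hxp, f, (h.2.2 x hx).1.symm.trans hf⟩

/-- Variable nodes have no successors, so a path cannot pass through one. -/
theorem lab_of_functionAt_prefix {S : TermGraph L V N} {p q : List ℕ} (hp : S.FunctionAt p)
    (hq : q <+: p) : ∃ u, q ∈ S.pos u ∧ ∃ f, S.lab u = Sum.inl f := by
  obtain ⟨r, rfl⟩ := hq
  obtain ⟨u, hu, f, hf⟩ := hp
  obtain ⟨x, hx, hxu⟩ := LGraph.path_append.1 hu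
  refine ⟨x, hx, ?_⟩
  cases r with
  | nil => exact ⟨f, by rw [show x = u from hxu]; exact hf⟩
  | cons i r =>
    rcases hl : S.lab x with g | z
    · exact ⟨g, rfl⟩
    · obtain ⟨y, hy, -⟩ := hxu
      simp [S.var_succ x (S.mem_of_pos hx) z hl] at hy

theorem pos_root (S : TermGraph L V N) : S.pos S.root = {[]} := by
  ext q
  constructor
  · exact fun hq => S.path_self S.root_mem hq
  · rintro rfl
    exact rfl

/-- A second position of `v`, extended by the rest of the path to `u`, would be a second position of
`u`. -/
theorem pos_eq_singleton_of_prefix {S : TermGraph L V N} {u v : N} {p q : List ℕ}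
    (hu : S.pos u = {p}) (hq : q <+: p) (hv : q ∈ S.pos v) : S.pos v = {q} := by
  obtain ⟨r, rfl⟩ := hq
  have hu' : q ++ r ∈ S.pos u := by rw [hu]; rfl
  obtain ⟨x, hx, hxu⟩ := LGraph.path_append.1 hu'
  obtain rfl : x = v := LGraph.Path.unique hx hv
  ext q'
  constructor
  · intro hq'
    have : q' ++ r ∈ S.pos u := LGraph.path_append.2 ⟨x, hq', hxu⟩
    rw [hu] at this
    exact List.append_cancel_right this
  · rintro rfl
    exact hv

end TermGraph

theorem StrictlyBelow.succ {S : TermGraph L V N} {p : List ℕ} {u v : N} (h : StrictlyBelow S p u)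
    (hv : v ∈ S.succ u) : StrictlyBelow S p v := by
  obtain ⟨q, hq, ⟨r, rfl⟩, -⟩ := h
  obtain ⟨i, hi⟩ := List.mem_iff_getElem?.1 hv
  refine ⟨p ++ r ++ [i], LGraph.path_concat.2 ⟨u, hq, hi⟩, ?_, ?_⟩
  · rw [List.append_assoc]
    exact List.prefix_append _ _
  · intro e
    have := congrArg List.length e
    simp at this

section Fold

variable [LinearOrder N]

theorem exists_fold {S : TermGraph L V N} {u v : N} (hu : u ∈ S.nodes) (hv : v ∈ S.nodes)
    (h : v < u) (hl : S.lab u = S.lab v) (hs : S.succ u = S.succ v) : ∃ T, Fold u v S T := by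
  set m : N → N := Function.update id u v with hm
  have hmu : m u = v := by simp [hm]
  have hmne : ∀ x, x ≠ u → m x = x := fun x hx => by simp [hm, hx]
  let H : LGraph N (Label L V) :=
    { nodes := S.nodes.erase u, succ := fun x => (S.succ x).map m, lab := S.lab, root := m S.root }
  have hc : S.Collapses m H := by
    refine ⟨fun x hx => ?_, rfl, fun x _ => ?_⟩
    · by_cases e : x = u
      · subst e
        rw [hmu]
        exact Finset.mem_erase.2 ⟨h.ne, hv⟩
      · rw [hmne x e]
        exact Finset.mem_erase.2 ⟨e, hx⟩
    · by_cases e : x = u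
      · subst e
        rw [hmu]
        exact ⟨hl.symm, by simp only [H, hs]⟩
      · rw [hmne x e]
        exact ⟨rfl, rfl⟩
  refine ⟨TermGraph.ofCollapses S m H hc fun y hy => ?_, hu, hv, h, hc⟩
  have hy := Finset.mem_erase.1 hy
  exact ⟨y, hy.2, hmne y hy.1⟩

/-- The termination measure for folding: collapses are surjective, and `u` is no longer hit. -/
theorem Fold.card_lt {S T : TermGraph L V N} {u v : N} (h : Fold u v S T) :
    T.nodes.card < S.nodes.card := by
  obtain ⟨hu, hv, hlt, hc⟩ := h
  refine (Finset.card_le_card fun y hy => ?_).trans_lt (Finset.card_erase_lt_of_mem hu)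
  obtain ⟨x, hx, rfl⟩ := TermGraph.surj_of_collapses hc hy
  by_cases e : x = u
  · subst e
    simpa using ⟨hlt.ne, hv⟩
  · simpa [e] using hx

theorem exists_normalFormOf_foldsBelow (p : List ℕ) (S : TermGraph L V N) :
    ∃ T, NormalFormOf (FoldsBelow p) S T := by
  induction hn : S.nodes.card using Nat.strong_induction_on generalizing S with
  | _ n ih =>
    by_cases h : ∃ T, FoldsBelow p S T
    · obtain ⟨T, hT⟩ := h
      obtain ⟨u, v, -, -, hf⟩ := id hT
      obtain ⟨W, hW, hW'⟩ := ih _ (hn ▸ hf.card_lt) T rfl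
      exact ⟨W, hW.head hT, hW'⟩
    · exact ⟨S, .refl, fun T hT => h ⟨T, hT⟩⟩

/-- Below `p`, normal forms of folding represent each term by a single node. -/
theorem eq_of_rep_of_forall_not_foldsBelow {S : TermGraph L V N} {p : List ℕ}
    (hS : ∀ T, ¬ FoldsBelow p S T) {u v : N} {t : L.Term V} (hu : S.Rep u t) (hv : S.Rep v t)
    (hpu : StrictlyBelow S p u) (hpv : StrictlyBelow S p v) : u = v := by
  induction t generalizing u v with
  | var x => exact S.var_shared u hu.mem v hv.mem x hu.var_inv hv.var_inv
  | func f ts ih =>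
    obtain ⟨us, hlu, hsu, hus⟩ := hu.func_inv
    obtain ⟨vs, hlv, hsv, hvs⟩ := hv.func_inv
    have e : us = vs := funext fun i => ih i (hus i) (hvs i)
      (hpu.succ (by rw [hsu, List.mem_ofFn]; exact ⟨i, rfl⟩))
      (hpv.succ (by rw [hsv, List.mem_ofFn]; exact ⟨i, rfl⟩))
    subst e
    by_contra hne
    rcases lt_or_gt_of_ne hne with h | h
    · obtain ⟨T, hT⟩ := exists_fold hv.mem hu.mem h (hlv.trans hlu.symm) (hsv.trans hsu.symm)
      exact hS T ⟨v, u, hpv, hpu, hT⟩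
    · obtain ⟨T, hT⟩ := exists_fold hu.mem hv.mem h (hlu.trans hlv.symm) (hsu.trans hsv.symm)
      exact hS T ⟨u, v, hpu, hpv, hT⟩

/-- Both identified nodes have a position other than `p`, so neither is `x`, and `x` acquires no
position. -/
theorem FoldsBelow.pos_eq {S T : TermGraph L V N} {p : List ℕ} (h : FoldsBelow p S T) {x : N}
    (hx : S.pos x = {p}) : T.pos x = {p} := by
  obtain ⟨u, v, ⟨q, hq, -, hqp⟩, ⟨q', hq', -, hqp'⟩, -, -, -, hc⟩ := h
  have hxu : x ≠ u := by
    rintro rfl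
    rw [hx] at hq
    exact hqp hq.symm
  have hxv : x ≠ v := by
    rintro rfl
    rw [hx] at hq'
    exact hqp' hq'.symm
  ext r
  constructor
  · intro hr
    obtain ⟨y, -, hyr, e⟩ := TermGraph.exists_pos_of_collapses hc hr
    by_cases hyu : y = u
    · subst hyu
      exact absurd (by simpa using e.symm) hxv
    · rw [Function.update_of_ne hyu] at e
      subst e
      exact hx ▸ hyr
  · rintro rfl
    have := TermGraph.pos_subset_of_collapses hc x (hx ▸ rfl : r ∈ S.pos x)
    rwa [Function.update_of_ne hxu] at this

theorem FoldsBelow.term_eq {S T : TermGraph L V N} {p : List ℕ} (h : FoldsBelow p S T) :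
    T.term = S.term := by
  obtain ⟨u, v, -, -, -, -, -, hc⟩ := h
  exact TermGraph.term_eq_of_collapses hc

theorem FoldsBelow.functionAt_iff {S T : TermGraph L V N} {p : List ℕ} (h : FoldsBelow p S T) :
    S.FunctionAt p ↔ T.FunctionAt p := by
  obtain ⟨u, v, -, -, -, -, -, hc⟩ := h
  exact TermGraph.functionAt_iff_of_collapses hc p

theorem UnfoldsAbove.term_eq {S T : TermGraph L V N} {p : List ℕ} (h : UnfoldsAbove p S T) :
    T.term = S.term := by
  obtain ⟨u, v, ⟨-, -, -, hc⟩, -⟩ := h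
  exact (TermGraph.term_eq_of_collapses hc).symm

theorem UnfoldsAbove.functionAt_iff {S T : TermGraph L V N} {p : List ℕ}
    (h : UnfoldsAbove p S T) : S.FunctionAt p ↔ T.FunctionAt p := by
  obtain ⟨u, v, ⟨-, -, -, hc⟩, -⟩ := h
  exact (TermGraph.functionAt_iff_of_collapses hc p).symm

/-- A shared function node whose parent is unshared can be unfolded. -/
theorem exists_unfoldsAbove [NoMaxOrder N] {S : TermGraph L V N} {w v : N} {p q : List ℕ} {i : ℕ}
    (hw : S.pos w = {q}) (hv : (S.succ w)[i]? = some v) (hf : ∃ f, S.lab v = Sum.inl f)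
    (hne : S.pos v ≠ {q ++ [i]}) (hp : q ++ [i] <+: p) :
    ∃ T u, UnfoldsAbove p S T ∧ T.pos u = {q ++ [i]} := by
  have hqw : q ∈ S.pos w := hw ▸ rfl
  have hwS := S.mem_of_pos hqw
  have hqv : q ++ [i] ∈ S.pos v := LGraph.path_concat.2 ⟨w, hqw, hv⟩
  have hvS := S.mem_of_pos hqv
  have hwv : w ≠ v := by
    rintro rfl
    exact S.acyclic w (.single ⟨hwS, List.mem_of_getElem? hv⟩)
  have : Nonempty N := ⟨w⟩
  -- The copy `u` of `v` must be fresh and, for `Fold u v`, greater than `v`; a node above all nodes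
  -- of `S` is both.
  obtain ⟨b, hb⟩ := S.nodes.exists_le
  obtain ⟨u, hbu⟩ := exists_gt b
  have hlt : ∀ x ∈ S.nodes, x < u := fun x hx => (hb x hx).trans_lt hbu
  have huS : u ∉ S.nodes := fun h => lt_irrefl u (hlt u h)
  have hun : ∀ x ∈ S.nodes, x ≠ u := fun x hx => (hlt x hx).ne
  set m : N → N := Function.update id u v with hm
  have hmu : m u = v := by simp [hm]
  have hmne : ∀ x, x ≠ u → m x = x := fun x hx => by simp [hm, hx]
  have hmap : ∀ x ∈ S.nodes, (S.succ x).map m = S.succ x := fun x hx => by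
    conv_rhs => rw [← List.map_id (S.succ x)]
    exact List.map_congr_left fun y hy => hmne y (hun y (S.succ_mem x hx y hy))
  -- Only edge number `i` of `w` is moved from `v` to the copy `u`.
  let H : LGraph N (Label L V) :=
    { nodes := insert u S.nodes
      succ := fun x => if x = u then S.succ v else if x = w then (S.succ w).set i u else S.succ x
      lab := fun x => if x = u then S.lab v else S.lab x
      root := S.root }
  have hHu : H.succ u = S.succ v := if_pos rfl
  have hHw : H.succ w = (S.succ w).set i u := (if_neg (hun w hwS)).trans (if_pos rfl)
  have hHx : ∀ x ∈ S.nodes, x ≠ w → H.succ x = S.succ x := fun x hx hxw =>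
    (if_neg (hun x hx)).trans (if_neg hxw)
  have hc : H.Collapses m S.toLGraph := by
    refine ⟨fun x hx => ?_, hmne _ (hun _ S.root_mem), fun x hx => ?_⟩
    · rcases Finset.mem_insert.1 hx with rfl | hx
      · rwa [hmu]
      · rwa [hmne x (hun x hx)]
    · rcases Finset.mem_insert.1 hx with rfl | hx
      · rw [hmu, hHu, hmap v hvS]
        exact ⟨(if_pos rfl).symm, rfl⟩
      · rw [hmne x (hun x hx)]
        refine ⟨(if_neg (hun x hx)).symm, ?_⟩
        by_cases e : x = w
        · subst e
          rw [hHw, List.map_set, hmap x hwS, hmu]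
          apply List.ext_getElem?
          intro j
          rw [List.getElem?_set]
          split_ifs with h₁ h₂
          · subst h₁
            exact hv
          · subst h₁
            exact List.getElem?_eq_none (not_lt.1 h₂)
          · rfl
        · rw [hHx x hx e, hmap x hx]
  have hcl : H.Closed := by
    intro x hx y hy
    apply Finset.mem_insert.2
    rcases Finset.mem_insert.1 hx with rfl | hxS
    · rw [hHu] at hy
      exact .inr (S.succ_mem v hvS y hy)
    · by_cases e : x = w
      · subst e
        rw [hHw] at hy
        rcases List.mem_or_eq_of_mem_set hy with h | h
        · exact .inr (S.succ_mem x hxS y h)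
        · exact .inl h
      · rw [hHx x hxS e] at hy
        exact .inr (S.succ_mem x hxS y hy)
  have hroot : H.root ∈ H.nodes := Finset.mem_insert_of_mem S.root_mem
  have hlift : ∀ {x : N} {r : List ℕ}, r ∈ S.pos x → ∃ y ∈ H.nodes, r ∈ H.pos y ∧ m y = x := by
    intro x r hr
    have hr' : S.Path (m H.root) r x := by rw [hc.2.1]; exact hr
    exact hc.lift_path hcl hroot hr'
  have hpush : ∀ {x : N} {r : List ℕ}, r ∈ H.pos x → r ∈ S.pos (m x) := by
    intro x r hr
    have := hc.path hcl hroot hr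
    rwa [hc.2.1] at this
  -- The moved edge is the only edge into `u`, and its source `w` has the single position `q`.
  have hposu : ∀ r ∈ H.pos u, r = q ++ [i] := by
    intro r hr
    rcases List.eq_nil_or_concat' r with rfl | ⟨r, j, rfl⟩
    · exact absurd hr (hun _ S.root_mem)
    · obtain ⟨x, hx, hxu⟩ := LGraph.path_concat.1 hr
      have hxH := LGraph.Path.mem hcl hroot hx
      have hmem := List.mem_of_getElem? hxu
      rcases Finset.mem_insert.1 hxH with rfl | hxS
      · rw [hHu] at hmem
        exact absurd (S.succ_mem v hvS _ hmem) huS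
      · by_cases e : x = w
        · subst e
          have := hpush hx
          rw [hmne x (hun x hxS), hw] at this
          rw [hHw, List.getElem?_set] at hxu
          split_ifs at hxu with h₁ h₂
          · rw [show r = q from this, h₁]
          · exact absurd (S.succ_mem x hxS u (List.mem_of_getElem? hxu)) huS
        · rw [hHx x hxS e] at hmem
          exact absurd (S.succ_mem x hxS u hmem) huS
  have hpos : H.pos u = {q ++ [i]} := by
    refine Set.Subset.antisymm hposu ?_
    rintro r rfl
    obtain ⟨y, hyH, hy, e⟩ := hlift hqw
    have hyw : y = w := by
      by_cases hyu : y = u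
      · subst hyu
        exact absurd (hmu.symm.trans e).symm hwv
      · exact (hmne y hyu).symm.trans e
    subst hyw
    refine LGraph.path_concat.2 ⟨y, hy, ?_⟩
    rw [hHw, List.getElem?_set, if_pos rfl, if_pos (List.getElem?_eq_some_iff.1 hv).1]
  have hreach : ∀ x ∈ H.nodes, H.Reach H.root x := by
    intro x hx
    suffices ∃ r, r ∈ H.pos x by
      obtain ⟨r, hr⟩ := this
      exact hr.reach hcl hroot
    rcases Finset.mem_insert.1 hx with rfl | hxS
    · exact ⟨q ++ [i], hpos ▸ rfl⟩
    · obtain ⟨r, hr, hrne⟩ : ∃ r ∈ S.pos x, x = v → r ≠ q ++ [i] := by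
        by_cases e : x = v
        · subst e
          by_contra! hcon
          refine hne (Set.Subset.antisymm (fun r hr => (hcon r hr).2) ?_)
          rintro r rfl
          exact hqv
        · obtain ⟨r, hr⟩ := S.exists_pos hxS
          exact ⟨r, hr, fun h => absurd h e⟩
      obtain ⟨y, hyH, hy, e⟩ := hlift hr
      refine ⟨r, ?_⟩
      by_cases hyu : y = u
      · subst hyu
        exact absurd (hposu r hy) (hrne (e.symm.trans hmu))
      · rw [hmne y hyu] at e
        exact e ▸ hy
  let T : TermGraph L V N := TermGraph.ofRep H hroot
    (by
      intro x hx
      obtain ⟨t, ht⟩ := S.exists_rep (hc.1 hx)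
      exact ⟨t, hc.rep_of_image hcl hx ht⟩)
    (by
      intro x hx z hz
      have h := hc.2.2 x hx
      rw [← h.1] at hz
      rw [S.var_succ _ (hc.1 hx) z hz] at h
      exact List.map_eq_nil_iff.1 h.2.symm)
    hreach
    (by
      intro x hx y hy z hz hz'
      -- Here `hf` is needed: copying a variable node would make a second node for that variable.
      have key : ∀ x ∈ H.nodes, H.lab x = Sum.inr z → x ≠ u := by
        rintro x hx hxz rfl
        obtain ⟨f, hf⟩ := hf
        rw [← (hc.2.2 x hx).1, hmu, hf] at hxz
        cases hxz
      have := S.var_shared _ (hc.1 hx) _ (hc.1 hy) z ((hc.2.2 x hx).1.trans hz)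
        ((hc.2.2 y hy).1.trans hz')
      rwa [hmne x (key x hx hz), hmne y (key y hy hz')] at this)
  exact ⟨T, u, ⟨u, v, ⟨Finset.mem_insert_self _ _, Finset.mem_insert_of_mem hvS, hlt v hvS, hc⟩,
    q ++ [i], hpos, hp⟩, hpos⟩

/-- Copying a node requires an unshared parent, so the induction runs down the prefixes of `p`,
starting from the root, whose only position is `[]`. -/
theorem exists_unfolding [NoMaxOrder N] {S : TermGraph L V N} {p q : List ℕ}
    (hS : S.FunctionAt p) (hq : q <+: p) :
    ∃ T, Relation.ReflTransGen (UnfoldsAbove p) S T ∧ ∃ u, T.pos u = {q} := by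
  induction q using List.reverseRecOn with
  | nil => exact ⟨S, .refl, S.root, S.pos_root⟩
  | append_singleton q i ih =>
    obtain ⟨T, hT, w, hw⟩ := ih ((List.prefix_append _ _).trans hq)
    have hTp : T.FunctionAt p := by
      clear hw
      induction hT with
      | refl => exact hS
      | tail _ h ih => exact h.functionAt_iff.1 ih
    obtain ⟨v, hv, hvf⟩ := TermGraph.lab_of_functionAt_prefix hTp hq
    by_cases h : T.pos v = {q ++ [i]}
    · exact ⟨T, hT, v, h⟩
    · obtain ⟨x, hx, hxv⟩ := LGraph.path_concat.1 hv
      have hqw : q ∈ T.pos w := hw ▸ rfl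
      obtain rfl : x = w := LGraph.Path.unique hx hqw
      obtain ⟨U, u, hU, hu⟩ := exists_unfoldsAbove hw hxv hvf h hq
      exact ⟨U, hT.tail hU, u, hu⟩

/-- If `u` at position `q` is merged into `v`, then `v` has position `q` in `S`, and no other one
because `q` is a prefix of the unshared `p`. Positions of `v` in `T` persist in `S`, so `v` is
already at `q` in `T`, which forces `u = v`. -/
theorem not_unfoldsAbove_of_pos_eq {S T : TermGraph L V N} {p : List ℕ} {x : N}
    (hx : S.pos x = {p}) : ¬ UnfoldsAbove p S T := by
  rintro ⟨u, v, ⟨hu, hv, hlt, hc⟩, q, hq, hqp⟩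
  have h₁ := TermGraph.pos_subset_of_collapses hc u
  have h₂ := TermGraph.pos_subset_of_collapses hc v
  rw [Function.update_self] at h₁
  rw [Function.update_of_ne hlt.ne] at h₂
  have hqu : q ∈ T.pos u := hq ▸ rfl
  have h := TermGraph.pos_eq_singleton_of_prefix hx hqp (h₁ hqu)
  obtain ⟨r, hr⟩ := T.exists_pos hv
  have hrq : r = q := by
    have := h₂ hr
    change r ∈ S.pos v at this
    rwa [h] at this
  subst hrq
  exact hlt.ne (LGraph.Path.unique hr hqu)

theorem exists_normalFormOf_unfoldsAbove [NoMaxOrder N] {S : TermGraph L V N} {p : List ℕ}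
    (hS : S.FunctionAt p) : ∃ T, NormalFormOf (UnfoldsAbove p) S T := by
  obtain ⟨T, hT, u, hu⟩ := exists_unfolding hS (List.prefix_refl p)
  exact ⟨T, hT, fun _ => not_unfoldsAbove_of_pos_eq hu⟩

theorem exists_pos_eq_of_normal [NoMaxOrder N] {S : TermGraph L V N} {p : List ℕ}
    (hS : S.FunctionAt p) (hn : ∀ T, ¬ UnfoldsAbove p S T) : ∃ u, S.pos u = {p} := by
  obtain ⟨T, hT, u, hu⟩ := exists_unfolding hS (List.prefix_refl p)
  rcases hT.cases_head with rfl | ⟨U, hU, -⟩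
  · exact ⟨u, hu⟩
  · exact absurd hU (hn U)

/-- If `p` is a function position, then it is unshared after unfolding above `p` and folding
below `p`. -/
theorem NormalFormOf.unfold_fold [NoMaxOrder N] {S U W : TermGraph L V N} {p : List ℕ}
    (hU : NormalFormOf (UnfoldsAbove p) S U) (hW : NormalFormOf (FoldsBelow p) U W) :
    W.term = S.term ∧ (S.FunctionAt p ↔ W.FunctionAt p) ∧
      (W.FunctionAt p → ∃ u, W.pos u = {p}) := by
  obtain ⟨hSU, hU⟩ := hU
  obtain ⟨hUW, -⟩ := hW
  have h₁ : U.term = S.term ∧ (S.FunctionAt p ↔ U.FunctionAt p) := by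
    clear hU hUW
    induction hSU with
    | refl => exact ⟨rfl, Iff.rfl⟩
    | tail _ h ih => exact ⟨h.term_eq.trans ih.1, ih.2.trans h.functionAt_iff⟩
  have h₂ : W.term = U.term ∧ (U.FunctionAt p ↔ W.FunctionAt p) ∧
      ∀ u, U.pos u = {p} → W.pos u = {p} := by
    induction hUW with
    | refl => exact ⟨rfl, Iff.rfl, fun _ h => h⟩
    | tail _ h ih =>
      exact ⟨h.term_eq.trans ih.1, ih.2.1.trans h.functionAt_iff, fun u hu => h.pos_eq (ih.2.2 u hu)⟩
  refine ⟨h₂.1.trans h₁.1, h₁.2.trans h₂.2.1, fun h => ?_⟩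
  obtain ⟨u, hu⟩ := exists_pos_eq_of_normal (h₂.2.1.2 h) hU
  exact ⟨u, h₂.2.2 u hu⟩

end Fold

end TGR

/-! ### Renaming graph rewrite rules -/

namespace TGR

variable {L : Language} {V N : Type*}

namespace TermGraph

/-- Rename the nodes of a term graph. -/
def rename (e : Equiv.Perm N) (S : TermGraph L V N) : TermGraph L V N :=
  ofCollapses S e
    { nodes := S.nodes.map e.toEmbedding
      succ := fun x => (S.succ (e.symm x)).map e
      lab := fun x => S.lab (e.symm x)
      root := e S.root }
    ⟨fun x hx => by simpa using hx, rfl, fun x _ => by simp⟩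
    (fun y hy => ⟨e.symm y, by simpa using hy, e.apply_symm_apply y⟩)

theorem mem_nodes_rename {e : Equiv.Perm N} {S : TermGraph L V N} {x : N} :
    x ∈ (S.rename e).nodes ↔ e.symm x ∈ S.nodes := by
  change x ∈ S.nodes.map e.toEmbedding ↔ _
  simp only [Finset.mem_map_equiv]

theorem mem_varNodes_rename {e : Equiv.Perm N} {S : TermGraph L V N} {x : N} :
    x ∈ (S.rename e).varNodes ↔ e.symm x ∈ S.varNodes :=
  and_congr mem_nodes_rename Iff.rfl

theorem rename_isIso (e : Equiv.Perm N) (S : TermGraph L V N) :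
    (S.rename e).IsIso e.symm S.toLGraph := by
  refine ⟨⟨fun x hx => mem_nodes_rename.1 hx, e.symm_apply_apply _, fun x _ => ⟨rfl, ?_⟩⟩,
    fun x hx => mem_nodes_rename.1 hx, e.symm.injective.injOn, fun y hy => ⟨e y, ?_, by simp⟩⟩
  · change _ = ((S.succ (e.symm x)).map e).map e.symm
    simp
  · exact mem_nodes_rename.2 (by simpa using hy)

/-- A collapse can only add positions, and every node has at least one. -/
theorem Unshared.of_collapses {S T : TermGraph L V N} {m : N → N}
    (h : S.Collapses m T.toLGraph) {x : N} (hx : x ∈ S.nodes) (hu : T.Unshared (m x)) :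
    S.Unshared x := by
  obtain ⟨q, hq⟩ := hu
  obtain ⟨r, hr⟩ := S.exists_pos hx
  refine ⟨q, ?_⟩
  have hsub := pos_subset_of_collapses h x
  rw [hq] at hsub
  refine Set.Subset.antisymm hsub ?_
  rintro _ rfl
  have := hsub hr
  rw [Set.mem_singleton_iff] at this
  exact this ▸ hr

theorem MinimallySharing.of_collapses {S T : TermGraph L V N} {m : N → N}
    (h : S.Collapses m T.toLGraph) (hT : T.MinimallySharing) : S.MinimallySharing := by
  intro x hx
  rcases hT (m x) (h.1 hx) with hv | hu
  · obtain ⟨-, z, hz⟩ := hv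
    exact .inl ⟨hx, z, (h.2.2 x hx).1.symm.trans hz⟩
  · exact .inr (Unshared.of_collapses h hx hu)

end TermGraph

theorem exists_perm_forall_notMem [Infinite N] (A B : Finset N) :
    ∃ e : Equiv.Perm N, ∀ a ∈ A, e a ∉ B := by
  classical
  induction A using Finset.induction_on with
  | empty => exact ⟨1, by simp⟩
  | insert a A ha ih =>
    obtain ⟨e, he⟩ := ih
    -- Avoiding `A.image e` as well keeps the swap from disturbing the elements already moved.
    obtain ⟨c, hc⟩ := Infinite.exists_notMem_finset (B ∪ A.image e)
    simp only [Finset.mem_union, Finset.mem_image, not_or, not_exists, not_and] at hc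
    refine ⟨e.trans (Equiv.swap (e a) c), fun x hx => ?_⟩
    rcases Finset.mem_insert.1 hx with rfl | hx
    · simpa using hc.1
    · rw [Equiv.trans_apply, Equiv.swap_apply_of_ne_of_ne]
      · exact he x hx
      · exact fun h => ha (e.injective h ▸ hx)
      · exact hc.2 x hx

namespace GraphRule

/-- Rename the nodes of a graph rewrite rule. -/
def rename (e : Equiv.Perm N) (ρ : GraphRule L V N) : GraphRule L V N where
  lhs := ρ.lhs.rename e
  rhs := ρ.rhs.rename e
  sharing := by
    intro x hx hx'
    have h := ρ.sharing _ (TermGraph.mem_nodes_rename.1 hx) (TermGraph.mem_nodes_rename.1 hx')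
    exact ⟨h.1, congrArg (List.map e) h.2⟩
  lhs_root_not_var := by
    intro h
    have := TermGraph.mem_varNodes_rename.1 h
    rw [show (ρ.lhs.rename e).root = e ρ.lhs.root from rfl, e.symm_apply_apply] at this
    exact ρ.lhs_root_not_var this
  vars_subset := fun _ hx =>
    TermGraph.mem_varNodes_rename.2 (ρ.vars_subset (TermGraph.mem_varNodes_rename.1 hx))
  lhs_root_not_mem := by
    intro h
    have := TermGraph.mem_nodes_rename.1 h
    rw [show (ρ.lhs.rename e).root = e ρ.lhs.root from rfl, e.symm_apply_apply] at this
    exact ρ.lhs_root_not_mem this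

theorem exists_isRenaming [Infinite N] (ρ : GraphRule L V N) (S : TermGraph L V N) :
    ∃ ρ' : GraphRule L V N, ρ'.IsRenaming ρ S := by
  classical
  obtain ⟨e, he⟩ := exists_perm_forall_notMem (ρ.lhs.nodes ∪ ρ.rhs.nodes) S.nodes
  refine ⟨ρ.rename e, ⟨e.symm, e.symm.injective.injOn, TermGraph.rename_isIso e _,
    TermGraph.rename_isIso e _⟩, ?_, ?_⟩
  · rw [Finset.disjoint_right]
    intro x hx
    have := he _ (Finset.mem_union_left _ (TermGraph.mem_nodes_rename.1 hx))
    rwa [e.apply_symm_apply] at this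
  · rw [Finset.disjoint_right]
    intro x hx
    have := he _ (Finset.mem_union_right _ (TermGraph.mem_nodes_rename.1 hx))
    rwa [e.apply_symm_apply] at this

end GraphRule

theorem Simulates.of_isomorphic {ρ ρ' : GraphRule L V N} {l r : L.Term V} (h : Simulates ρ l r)
    (hρ : ρ'.Isomorphic ρ) : Simulates ρ' l r := by
  obtain ⟨φ, -, ⟨hl, -⟩, ⟨hr, -⟩⟩ := hρ
  refine ⟨⟨h.1.1.of_collapses hl, (TermGraph.term_eq_of_collapses hl).symm.trans h.1.2⟩,
    ⟨h.2.1.1.of_collapses hr, (TermGraph.term_eq_of_collapses hr).symm.trans h.2.1.2⟩, ?_⟩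
  ext x
  constructor
  · rintro ⟨hxl, hxr⟩
    have : φ x ∈ ρ.rhs.varNodes := h.2.2 ▸ ⟨hl.1 hxl, hr.1 hxr⟩
    obtain ⟨-, z, hz⟩ := this
    exact ⟨hxr, z, (hr.2.2 x hxr).1.symm.trans hz⟩
  · exact fun hx => ⟨(ρ'.vars_subset hx).1, hx.1⟩

/-! ### The graph produced by a rewrite step -/

namespace TermGraph

theorem rep_subst_of_isMorphism {A S : TermGraph L V N} {u : N} {m : N → N}
    {σ : V → L.Term V} (hm : A.IsMorphism m (S.subgraphAt u))
    (hσ : ∀ y ∈ A.nodes, ∀ z, A.lab y = Sum.inr z → S.Rep (m y) (σ z)) {x : N} {t : L.Term V}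
    (hx : A.Rep x t) : S.Rep (m x) (t.subst σ) := by
  induction hx with
  | var x z hx hl => exact hσ x hx z hl
  | func x f vs ts hx hl hs _ ih =>
    have hxv : x ∉ A.varNodes := by
      rintro ⟨-, z, hz⟩
      rw [hl] at hz
      cases hz
    have h := hm.2.2 x hx hxv
    refine .func _ f (m ∘ vs) _ ((S.mem_nodes_subgraphAt u _).1 (hm.1 hx)).1 (h.1.trans hl) ?_ ih
    refine h.2.trans ?_
    rw [hs, List.map_ofFn]

/-- A node with an outgoing edge is not a variable node, so morphisms preserve all edges, and with
them nonempty paths from the root. -/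
theorem reach_of_isMorphism {A S : TermGraph L V N} {u : N} {m : N → N}
    (hm : A.IsMorphism m (S.subgraphAt u)) {x : N} (hx : x ∈ A.nodes) (hne : x ≠ A.root) :
    Relation.TransGen S.Edge u (m x) := by
  have h : Relation.TransGen A.Edge A.root x := by
    rcases Relation.reflTransGen_iff_eq_or_transGen.1 (A.rooted x hx) with h | h
    · exact absurd h hne
    · exact h
  have hroot : m A.root = u := hm.2.1
  rw [← hroot]
  refine Relation.TransGen.lift m (r := A.Edge) ?_ _ _ h
  rintro a b ⟨ha, hb⟩
  have hav : a ∉ A.varNodes := by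
    rintro ⟨-, z, hz⟩
    simp [A.var_succ a ha z hz] at hb
  refine ⟨((S.mem_nodes_subgraphAt u _).1 (hm.1 ha)).1, ?_⟩
  have h := (hm.2.2 a ha hav).2
  change S.succ (m a) = _ at h
  rw [h]
  exact List.mem_map_of_mem hb

end TermGraph

/-- The data of a graph rewrite step at the node `u` of `S`, where `σ` is the substitution that
corresponds to the morphism `m`. -/
structure IsMatch (ρ : GraphRule L V N) (S : TermGraph L V N) (u : N) (m : N → N)
    (σ : V → L.Term V) : Prop where
  mem : u ∈ S.nodes
  disjoint_rhs : Disjoint S.nodes ρ.rhs.nodes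
  common : ∀ x ∈ ρ.lhs.nodes, x ∈ ρ.rhs.nodes → x ∈ ρ.rhs.varNodes
  morphism : ρ.lhs.IsMorphism m (S.subgraphAt u)
  rep : ∀ y ∈ ρ.lhs.nodes, ∀ z, ρ.lhs.lab y = Sum.inr z → S.Rep (m y) (σ z)

namespace IsMatch

variable [DecidableEq N] {ρ : GraphRule L V N} {S : TermGraph L V N} {u : N} {m : N → N}
  {σ : V → L.Term V}

/-- The graph `S[m(R)]ᵤ` before removing unreachable nodes. -/
abbrev result (ρ : GraphRule L V N) (S : TermGraph L V N) (u : N) (m : N → N) (r : N) :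
    LGraph N (Label L V) :=
  (S.redirect u (ρ.imageRhs m S).root).unionAt (ρ.imageRhs m S) r

/-- The right-hand side does not contain the root of the left-hand side, so it meets `S` only
strictly below `u`. -/
theorem transGen_of_mem (h : IsMatch ρ S u m σ) {x : N} (hx : x ∈ (ρ.imageRhs m S).nodes)
    (hxS : x ∈ S.nodes) : Relation.TransGen S.Edge u x := by
  obtain ⟨v, hv, rfl⟩ := Finset.mem_image.1 hx
  by_cases hvl : v ∈ ρ.lhs.nodes
  · rw [if_pos hvl]
    refine TermGraph.reach_of_isMorphism h.morphism hvl ?_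
    rintro rfl
    exact ρ.lhs_root_not_mem hv
  · rw [if_neg hvl] at hxS
    exact absurd hv (Finset.disjoint_left.1 h.disjoint_rhs hxS)

theorem lab_result {r x : N} (hx : x ∈ S.nodes) : (result ρ S u m r).lab x = S.lab x := by
  change (if x ∈ (ρ.imageRhs m S).nodes then (if x ∈ S.nodes then S.lab x else _) else S.lab x) = _
  rw [if_pos hx, ite_self]

/-- On common nodes the union keeps the unredirected successors. These nodes lie strictly below `u`,
so by acyclicity they have no edge into `u` and redirection would not alter them. -/
theorem succ_result (h : IsMatch ρ S u m σ) {r x : N} (hx : x ∈ S.nodes) :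
    (result ρ S u m r).succ x =
      (S.succ x).map (Function.update id u (ρ.imageRhs m S).root) := by
  change (if x ∈ (ρ.imageRhs m S).nodes then (if x ∈ S.nodes then S.succ x else _) else _) = _
  rw [if_pos hx]
  split_ifs with hxH
  · conv_lhs => rw [← List.map_id (S.succ x)]
    refine List.map_congr_left fun y hy => ?_
    rw [Function.update_of_ne]
    rintro rfl
    exact S.acyclic y ((h.transGen_of_mem hxH hx).tail ⟨hx, hy⟩)
  · rfl

theorem mem_result {r x : N} (hx : x ∈ S.nodes) (hxu : x ≠ u) :
    x ∈ (result ρ S u m r).nodes :=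
  Finset.mem_union_left _ (Finset.mem_erase.2 ⟨hxu, Finset.mem_insert_of_mem hx⟩)

theorem rep_of_not_reach (h : IsMatch ρ S u m σ) {r x : N} {t : L.Term V} (hx : S.Rep x t)
    (hr : ¬ S.Reach x u) : (result ρ S u m r).Rep x t := by
  have hne : ∀ {x}, ¬ S.Reach x u → x ≠ u := by
    rintro x hr rfl
    exact hr .refl
  induction hx with
  | var x z hx hl => exact .var x z (mem_result hx (hne hr)) ((lab_result hx).trans hl)
  | func x f vs ts hx hl hs _ ih =>
    have hr' : ∀ i, ¬ S.Reach (vs i) u := fun i hi =>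
      hr (hi.head ⟨hx, by rw [hs, List.mem_ofFn]; exact ⟨i, rfl⟩⟩)
    refine .func x f vs ts (mem_result hx (hne hr)) ((lab_result hx).trans hl) ?_
      fun i => ih i (hr' i)
    rw [h.succ_result hx, hs, List.map_ofFn]
    congr 1
    funext i
    exact Function.update_of_ne (hne (hr' i)) _ _

/-- Variable nodes are mapped strictly below `u`; by acyclicity they do not reach `u` and keep their
terms. All other nodes of the right-hand side are new. -/
theorem rep_rhs (h : IsMatch ρ S u m σ) {r v : N} {t : L.Term V} (hv : ρ.rhs.Rep v t) :
    (result ρ S u m r).Rep (if v ∈ ρ.lhs.nodes then m v else v) (t.subst σ) := by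
  induction hv with
  | var v z hv hl =>
    have hvl : v ∈ ρ.lhs.nodes := (ρ.vars_subset ⟨hv, z, hl⟩).1
    rw [if_pos hvl]
    have hvr : v ≠ ρ.lhs.root := by
      rintro rfl
      exact ρ.lhs_root_not_mem hv
    refine h.rep_of_not_reach (h.rep v hvl z ((ρ.sharing v hvl hv).1.trans hl)) fun hr => ?_
    exact S.acyclic u ((TermGraph.reach_of_isMorphism h.morphism hvl hvr).trans_left hr)
  | func v f vs ts hv hl hs _ ih =>
    have hvl : v ∉ ρ.lhs.nodes := by
      intro hvl
      obtain ⟨-, z, hz⟩ := h.common v hvl hv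
      rw [hl] at hz
      cases hz
    have hvS : v ∉ S.nodes := Finset.disjoint_right.1 h.disjoint_rhs hv
    have hvH : v ∈ (ρ.imageRhs m S).nodes := Finset.mem_image.2 ⟨v, hv, if_neg hvl⟩
    rw [if_neg hvl]
    refine .func v f (fun i => if vs i ∈ ρ.lhs.nodes then m (vs i) else vs i) _
      (Finset.mem_union_right _ hvH) ?_ ?_ ih
    · change (if v ∈ (ρ.imageRhs m S).nodes then (if v ∈ S.nodes then S.lab v else ρ.rhs.lab v)
        else _) = _
      rw [if_pos hvH, if_neg hvS, hl]
    · change (if v ∈ (ρ.imageRhs m S).nodes then (if v ∈ S.nodes then S.succ v else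
        (ρ.rhs.succ v).map (fun v => if v ∈ ρ.lhs.nodes then m v else v)) else _) = _
      rw [if_pos hvH, if_neg hvS, hs, List.map_ofFn]
      rfl

theorem rep_root_rhs (h : IsMatch ρ S u m σ) {r : N} {t : L.Term V} (ht : ρ.rhs.term = t) :
    (result ρ S u m r).Rep (ρ.imageRhs m S).root (t.subst σ) :=
  h.rep_rhs (TermGraph.rep_root_iff.2 ht)

/-- Used to show that redirection creates no cycle; which term arises does not matter, and `u` may
be shared. -/
theorem exists_rep_redirect (h : IsMatch ρ S u m σ) {r x : N} {t : L.Term V} (hx : S.Rep x t) :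
    ∃ t', (result ρ S u m r).Rep (Function.update id u (ρ.imageRhs m S).root x) t' := by
  induction hx with
  | var x z hx hl =>
    by_cases e : x = u
    · subst e
      rw [Function.update_self]
      exact ⟨_, h.rep_root_rhs rfl⟩
    · rw [Function.update_of_ne e]
      exact ⟨_, .var x z (mem_result hx e) ((lab_result hx).trans hl)⟩
  | func x f vs ts hx hl hs _ ih =>
    by_cases e : x = u
    · subst e
      rw [Function.update_self]
      exact ⟨_, h.rep_root_rhs rfl⟩
    · rw [Function.update_of_ne e]
      choose ts' hts' using ih
      refine ⟨_, .func x f _ ts' (mem_result hx e) ((lab_result hx).trans hl) ?_ hts'⟩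
      rw [h.succ_result hx, hs, List.map_ofFn]
      rfl

theorem exists_rep (h : IsMatch ρ S u m σ) {r x : N} (hx : x ∈ (result ρ S u m r).nodes) :
    ∃ t, (result ρ S u m r).Rep x t := by
  rcases Finset.mem_union.1 hx with hx | hx
  · obtain ⟨hxu, hx⟩ := Finset.mem_erase.1 hx
    rcases Finset.mem_insert.1 hx with rfl | hx
    · exact ⟨_, h.rep_root_rhs rfl⟩
    · obtain ⟨t, ht⟩ := S.exists_rep hx
      obtain ⟨t', ht'⟩ := h.exists_rep_redirect (r := r) ht
      rw [Function.update_of_ne hxu] at ht'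
      exact ⟨t', ht'⟩
  · obtain ⟨v, hv, rfl⟩ := Finset.mem_image.1 hx
    obtain ⟨t, ht⟩ := ρ.rhs.exists_rep hv
    exact ⟨_, h.rep_rhs ht⟩

/-- Variables of the right-hand side occur in the left-hand side, hence are instantiated in `S`. The
result thus inherits the sharing of variables. -/
theorem mem_of_lab_eq_var {r x : N} {z : V} (hx : x ∈ (result ρ S u m r).nodes)
    (h : IsMatch ρ S u m σ) (hl : (result ρ S u m r).lab x = Sum.inr z) : x ∈ S.nodes := by
  by_contra hxS
  have hxH : x ∈ (ρ.imageRhs m S).nodes := by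
    rcases Finset.mem_union.1 hx with hx | hx
    · rcases Finset.mem_insert.1 (Finset.mem_erase.1 hx).2 with rfl | hx
      · exact Finset.mem_image_of_mem _ ρ.rhs.root_mem
      · exact absurd hx hxS
    · exact hx
  change (if x ∈ (ρ.imageRhs m S).nodes then (if x ∈ S.nodes then S.lab x else ρ.rhs.lab x)
    else _) = _ at hl
  rw [if_pos hxH, if_neg hxS] at hl
  obtain ⟨v, hv, rfl⟩ := Finset.mem_image.1 hxH
  by_cases hvl : v ∈ ρ.lhs.nodes
  · rw [if_pos hvl] at hxS
    exact hxS ((S.mem_nodes_subgraphAt u _).1 (h.morphism.1 hvl)).1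
  · rw [if_neg hvl] at hl
    exact hvl (ρ.vars_subset ⟨hv, z, hl⟩).1

/-- The context is followed down to `u`, with `q` as the part of the path already walked. An
argument beside the path cannot reach `u`, for this would give `u` a second position; so
`rep_of_not_reach` leaves its term intact. -/
theorem rep_plug (h : IsMatch ρ S u m σ) {r : N} {b : L.Term V}
    (hb : (result ρ S u m r).Rep (ρ.imageRhs m S).root b) (C : Context L V) {x : N} {q : List ℕ}
    {a : L.Term V} (hq : q ∈ S.pos x) (hu : S.pos u = {q ++ C.holePos})
    (hx : S.Rep x (C.plug a)) :
    (result ρ S u m r).Rep (Function.update id u (ρ.imageRhs m S).root x) (C.plug b) := by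
  induction C generalizing x q with
  | hole =>
    have hqu : q ∈ S.pos u := by rw [hu]; exact (List.append_nil q).symm
    obtain rfl : x = u := LGraph.Path.unique hq hqu
    rw [Function.update_self]
    exact hb
  | @arg n f ts i C ih =>
    have hqu : q ++ (i : ℕ) :: C.holePos ∈ S.pos u := by rw [hu]; rfl
    have hxu : x ≠ u := by
      rintro rfl
      rw [hu] at hq
      simpa [Context.holePos] using (congrArg List.length (Set.mem_singleton_iff.1 hq))
    obtain ⟨vs, hl, hs, hvs⟩ := hx.func_inv
    have hget : ∀ j : Fin n, (S.succ x)[(j : ℕ)]? = some (vs j) := fun j => by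
      rw [hs]
      simp
    rw [Function.update_of_ne hxu]
    refine .func x f (fun j => Function.update id u (ρ.imageRhs m S).root (vs j)) _
      (mem_result hx.mem hxu) ((lab_result hx.mem).trans hl) ?_ ?_
    · rw [h.succ_result hx.mem, hs, List.map_ofFn]
      rfl
    · intro j
      by_cases hj : j = i
      · subst hj
        rw [Function.update_self]
        have hv := hvs j
        rw [Function.update_self] at hv
        refine ih (q := q ++ [(j : ℕ)]) (LGraph.path_concat.2 ⟨x, hq, hget j⟩) ?_ hv
        rw [hu]
        simp [Context.holePos]
      · have hv := hvs j
        rw [Function.update_of_ne hj] at hv ⊢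
        have hr : ¬ S.Reach (vs j) u := by
          intro hr
          obtain ⟨p', hp'⟩ := LGraph.Reach.exists_path hr
          have : q ++ (j : ℕ) :: p' ∈ S.pos u :=
            LGraph.path_append.2 ⟨x, hq, vs j, hget j, hp'⟩
          rw [hu] at this
          have := List.append_cancel_left this
          simp only [Context.holePos, List.cons.injEq] at this
          exact hj (Fin.ext this.1)
        rw [Function.update_of_ne]
        · exact h.rep_of_not_reach hv hr
        · intro e
          exact hr (e ▸ .refl)

theorem rep_replaceAt (h : IsMatch ρ S u m σ) {C : Context L V} {l r : L.Term V}
    (hu : S.pos u = {C.holePos}) (hS : S.term = C.plug l) (hr : ρ.rhs.term = r) :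
    (S.replaceAt u (ρ.imageRhs m S)).Rep (S.replaceAt u (ρ.imageRhs m S)).root
      (C.plug (r.subst σ)) := by
  have key := h.rep_plug (r := if u = S.root then (ρ.imageRhs m S).root else S.root)
    (h.rep_root_rhs hr) C (q := []) rfl hu (TermGraph.rep_root_iff.2 hS)
  have e : Function.update id u (ρ.imageRhs m S).root S.root =
      if u = S.root then (ρ.imageRhs m S).root else S.root := by
    by_cases e : u = S.root
    · rw [e, Function.update_self, if_pos rfl]
    · rw [Function.update_of_ne (Ne.symm e), if_neg e]
      rfl
  rw [e] at key
  exact key.subgraphAt .refl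

theorem exists_same (h : IsMatch ρ S u m σ) :
    ∃ T : TermGraph L V N, T.Same (S.replaceAt u (ρ.imageRhs m S)) := by
  have hroot : (if u = S.root then (ρ.imageRhs m S).root else S.root) ∈
      (result ρ S u m (if u = S.root then (ρ.imageRhs m S).root else S.root)).nodes := by
    split_ifs with e
    · exact Finset.mem_union_right _ (Finset.mem_image_of_mem _ ρ.rhs.root_mem)
    · exact mem_result S.root_mem (Ne.symm e)
  set r := if u = S.root then (ρ.imageRhs m S).root else S.root with hr
  set X := result ρ S u m r with hX
  have hE : S.replaceAt u (ρ.imageRhs m S) = X.subgraphAt r := rfl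
  rw [hE]
  have hmem : ∀ {x}, x ∈ (X.subgraphAt r).nodes → x ∈ X.nodes ∧ X.Reach r x := fun hx =>
    (X.mem_nodes_subgraphAt r _).1 hx
  refine ⟨TermGraph.ofRep (X.subgraphAt r) ?_ ?_ ?_ ?_ ?_, rfl, rfl, fun _ _ => ⟨rfl, rfl⟩⟩
  · exact (X.mem_nodes_subgraphAt r r).2 ⟨hroot, .refl⟩
  · intro x hx
    obtain ⟨t, ht⟩ := h.exists_rep (hmem hx).1
    exact ⟨t, ht.subgraphAt (hmem hx).2⟩
  · intro x hx z hz
    have hxS := mem_of_lab_eq_var (hmem hx).1 h hz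
    have hz' : S.lab x = Sum.inr z := (lab_result (r := r) hxS).symm.trans hz
    change X.succ x = []
    rw [hX, h.succ_result hxS, S.var_succ x hxS z hz', List.map_nil]
  · intro x hx
    have := (hmem hx).2
    clear hx
    change (X.subgraphAt r).Reach r x
    induction this with
    | refl => exact .refl
    | tail hab e ih => exact ih.tail ⟨(X.mem_nodes_subgraphAt r _).2 ⟨e.1, hab⟩, e.2⟩
  · intro x hx y hy z hz hz'
    have hxS := mem_of_lab_eq_var (hmem hx).1 h hz
    have hyS := mem_of_lab_eq_var (hmem hy).1 h hz'
    exact S.var_shared x hxS y hyS z ((lab_result (r := r) hxS).symm.trans hz)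
      ((lab_result (r := r) hyS).symm.trans hz')

end IsMatch

end TGR

/-! ### Matching, soundness and completeness -/

namespace TGR

variable {L : Language} {V N : Type*}

namespace LGraph

theorem Rep.exists_path_holePos {G : LGraph N (Label L V)} {C : Context L V} {u : N}
    {t : L.Term V} (h : G.Rep u (C.plug t)) : ∃ v, G.Path u C.holePos v ∧ G.Rep v t := by
  induction C generalizing u with
  | hole => exact ⟨u, rfl, h⟩
  | arg f ts i C ih =>
    obtain ⟨vs, hl, hs, hvs⟩ := h.func_inv
    have hv := hvs i
    rw [Function.update_self] at hv
    obtain ⟨v, hv, hvt⟩ := ih hv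
    exact ⟨v, ⟨vs i, by rw [hs]; simp, hv⟩, hvt⟩

theorem Rep.exists_context {G : LGraph N (Label L V)} {u v : N} {s : L.Term V} {p : List ℕ}
    (hvar : ∀ u ∈ G.nodes, ∀ x : V, G.lab u = Sum.inr x → G.succ u = [])
    (hs : G.Rep u s) (hp : G.Path u p v) :
    ∃ (C : Context L V) (t : L.Term V), C.holePos = p ∧ G.Rep v t ∧ s = C.plug t := by
  induction p generalizing u s with
  | nil =>
    obtain rfl : u = v := hp
    exact ⟨.hole, s, rfl, hs, rfl⟩
  | cons i p ih =>
    obtain ⟨w, hw, hp⟩ := hp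
    cases hs with
    | var _ x hu hl => simp [hvar u hu x hl] at hw
    | @func _ n f vs ts hu hl hs h =>
      rw [hs, List.getElem?_ofFn] at hw
      split_ifs at hw with hi
      cases hw
      obtain ⟨C, t, hC, ht, e⟩ := ih (h ⟨i, hi⟩) hp
      refine ⟨.arg f ts ⟨i, hi⟩ C, t, by rw [Context.holePos, hC], ht, ?_⟩
      rw [Context.plug, ← e, Function.update_eq_self]

/-- A path in the unravelling of `t` can be followed in the unravelling of an instance of `t`. -/
theorem Rep.exists_path_subst {G H : LGraph N (Label L V)} {σ : V → L.Term V} {x x' y : N}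
    {t : L.Term V} {q : List ℕ} (hvar : ∀ u ∈ G.nodes, ∀ x : V, G.lab u = Sum.inr x → G.succ u = [])
    (hx : G.Rep x t) (hy : H.Rep y (t.subst σ)) (hq : G.Path x q x') :
    ∃ y' t', H.Path y q y' ∧ G.Rep x' t' ∧ H.Rep y' (t'.subst σ) := by
  induction q generalizing x y t with
  | nil =>
    obtain rfl : x = x' := hq
    exact ⟨y, t, rfl, hx, hy⟩
  | cons i q ih =>
    obtain ⟨w, hw, hq⟩ := hq
    cases hx with
    | var _ z hu hl => simp [hvar x hu z hl] at hw
    | @func _ n f vs ts hu hl hs h =>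
      rw [hs, List.getElem?_ofFn] at hw
      split_ifs at hw with hi
      cases hw
      obtain ⟨ws, -, hs', hws⟩ := hy.func_inv
      obtain ⟨y', t', hy', h₁, h₂⟩ := ih (h ⟨i, hi⟩) (hws ⟨i, hi⟩) hq
      refine ⟨y', t', ⟨ws ⟨i, hi⟩, ?_, hy'⟩, h₁, h₂⟩
      rw [hs', List.getElem?_ofFn, dif_pos hi]

end LGraph

/-- If equal terms strictly below `p` are represented by the same node, then each minimally sharing
term graph matches wherever the term it represents does. -/
theorem exists_isMorphism {A S : TermGraph L V N} {u : N} {p : List ℕ} {l : L.Term V}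
    {σ : V → L.Term V} (hA : A.MinimallySharing) (hl : A.term = l) (hroot : A.root ∉ A.varNodes)
    (hu : p ∈ S.pos u) (hS : S.Rep u (l.subst σ))
    (hmax : ∀ x y t, S.Rep x t → S.Rep y t → StrictlyBelow S p x → StrictlyBelow S p y → x = y) :
    ∃ m, A.IsMorphism m (S.subgraphAt u) ∧
      ∀ y ∈ A.nodes, ∀ z, A.lab y = Sum.inr z → S.Rep (m y) (σ z) := by
  have hAr := TermGraph.rep_root_iff.2 hl
  have huS := S.mem_of_pos hu
  -- The morphism sends `x` to the node of `S` reached from `u` along some position of `x`; `key`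
  -- shows that the choice of position is immaterial.
  have hex : ∀ x : N, ∃ y, x ∈ A.nodes → ∃ q, A.Path A.root q x ∧ S.Path u q y := by
    intro x
    by_cases hx : x ∈ A.nodes
    · obtain ⟨q, hq⟩ := A.exists_pos hx
      obtain ⟨y, -, hy, -, -⟩ := hAr.exists_path_subst A.var_succ hS hq
      exact ⟨y, fun _ => ⟨q, hq, hy⟩⟩
    · exact ⟨x, fun h => absurd h hx⟩
  choose m hm using hex
  -- The root of `A` is not a variable node, so `q` is nonempty and the image lies strictly below
  -- `p`, where `hmax` applies.
  have hvarRep : ∀ {x q y}, ∀ z, x ∈ A.nodes → A.lab x = Sum.inr z → A.Path A.root q x →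
      S.Path u q y → S.Rep y (σ z) ∧ StrictlyBelow S p y := by
    intro x q y z hx hz hq hy
    obtain ⟨y', t, hy', hxt, hyt⟩ := hAr.exists_path_subst A.var_succ hS hq
    obtain rfl := LGraph.Path.unique hy hy'
    obtain rfl := TermGraph.rep_unique hxt (.var x z hx hz)
    refine ⟨hyt, p ++ q, LGraph.path_append.2 ⟨u, hu, hy⟩, List.prefix_append _ _, fun e => ?_⟩
    have hq0 : q = [] := List.append_right_eq_self.1 e.symm
    subst hq0
    obtain rfl : A.root = x := hq
    exact hroot ⟨hx, z, hz⟩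
  have key : ∀ {x q}, A.Path A.root q x → S.Path u q (m x) := by
    intro x q hq
    have hx := LGraph.Path.mem A.closed A.root_mem hq
    obtain ⟨q', hq', hy'⟩ := hm x hx
    -- Two positions of a variable node lead to nodes representing the same `σ z`, identified by
    -- `hmax`; any other node has only one position.
    rcases hA x hx with ⟨-, z, hz⟩ | ⟨r, hr⟩
    · obtain ⟨y, -, hy, -, -⟩ := hAr.exists_path_subst A.var_succ hS hq
      obtain ⟨h₁, h₂⟩ := hvarRep z hx hz hq hy
      obtain ⟨h₁', h₂'⟩ := hvarRep z hx hz hq' hy'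
      exact hmax _ _ _ h₁ h₁' h₂ h₂' ▸ hy
    · have e : q = r := by
        have : q ∈ A.pos x := hq
        rwa [hr] at this
      have e' : q' = r := by
        have : q' ∈ A.pos x := hq'
        rwa [hr] at this
      rw [e, ← e']
      exact hy'
  refine ⟨m, ⟨fun x hx => ?_, ?_, fun x hx hxv => ?_⟩, fun y hy z hz => ?_⟩
  · obtain ⟨q, -, hq⟩ := hm x hx
    exact (S.mem_nodes_subgraphAt u _).2 ⟨hq.mem S.closed huS, hq.reach S.closed huS⟩
  · exact (key (q := []) rfl : u = m A.root).symm
  · obtain ⟨q, hq⟩ := A.exists_pos hx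
    obtain ⟨y, t, hy, hxt, hyt⟩ := hAr.exists_path_subst A.var_succ hS hq
    obtain rfl := LGraph.Path.unique hy (key hq)
    cases hxt with
    | var _ z _ hz => exact absurd ⟨hx, z, hz⟩ hxv
    | func _ f vs ts _ hl hs h =>
      obtain ⟨ws, hl', hs', hws⟩ := hyt.func_inv
      refine ⟨hl'.trans hl.symm, ?_⟩
      change S.succ (m x) = _
      rw [hs, hs', List.map_ofFn]
      congr 1
      funext i
      have h₁ : S.Path u (q ++ [(i : ℕ)]) (m (vs i)) :=
        key (LGraph.path_concat.2 ⟨x, hq, by rw [hs]; simp⟩)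
      have h₂ : S.Path u (q ++ [(i : ℕ)]) (ws i) :=
        LGraph.path_concat.2 ⟨m x, hy, by rw [hs']; simp⟩
      exact h₂.unique h₁
  · obtain ⟨q, hq, hq'⟩ := hm y hy
    exact (hvarRep z hy hz hq hq').1

/-- Graph rewriting at an unshared position is sound for term rewriting. -/
theorem rewritesAt_of_graphRewritesAt [DecidableEq N] {R : TRS L V} {G : Set (GraphRule L V N)}
    (hG : IsSimulatingGRS R G) {p : List ℕ} {S T : TermGraph L V N}
    (hp : S.FunctionAt p → ∃ u, S.pos u = {p}) (h : GraphRewritesAt G p S T) :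
    R.RewritesAt p S.term T.term := by
  obtain ⟨u, hpu, huS, γ, hγ, ρ, ⟨hiso, -, hd⟩, m, hm, hT⟩ := h
  obtain ⟨⟨l, r⟩, hR, hsim⟩ := hG.2 γ hγ
  obtain ⟨⟨-, hl⟩, ⟨-, hr⟩, hcom⟩ := hsim.of_isomorphic hiso
  have hroot : m ρ.lhs.root = u := hm.2.1
  have hf : S.FunctionAt p := by
    refine ⟨u, hpu, ?_⟩
    have hlab : S.lab (m ρ.lhs.root) = _ := (hm.2.2 _ ρ.lhs.root_mem ρ.lhs_root_not_var).1
    rw [hroot] at hlab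
    rcases hf : ρ.lhs.lab ρ.lhs.root with f | z
    · exact ⟨f, hlab.trans hf⟩
    · exact absurd ⟨ρ.lhs.root_mem, z, hf⟩ ρ.lhs_root_not_var
  obtain ⟨u', hu'⟩ := hp hf
  have hpu' : p ∈ S.pos u' := hu' ▸ rfl
  obtain rfl : u' = u := LGraph.Path.unique hpu' hpu
  -- The substitution is read off the morphism, unambiguously because each variable labels at most
  -- one node; variables absent from the left-hand side go to themselves.
  have hσ : ∀ z : V, ∃ t, ∀ y ∈ ρ.lhs.nodes, ρ.lhs.lab y = Sum.inr z → S.Rep (m y) t := by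
    intro z
    by_cases hz : ∃ y ∈ ρ.lhs.nodes, ρ.lhs.lab y = Sum.inr z
    · obtain ⟨y, hy, hyz⟩ := hz
      obtain ⟨t, ht⟩ := S.exists_rep ((S.mem_nodes_subgraphAt _ _).1 (hm.1 hy)).1
      exact ⟨t, fun y' hy' hyz' => ρ.lhs.var_shared y hy y' hy' z hyz hyz' ▸ ht⟩
    · exact ⟨.var z, fun y hy hyz => absurd ⟨y, hy, hyz⟩ hz⟩
  choose σ hσ using hσ
  have hmatch : IsMatch ρ S u' m σ :=
    ⟨huS, hd, fun x hx hx' => hcom ▸ ⟨hx, hx'⟩, hm, fun y hy z hz => hσ z y hy hz⟩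
  have hul : S.Rep u' (l.subst σ) := by
    have := TermGraph.rep_subst_of_isMorphism hm hmatch.rep (TermGraph.rep_root_iff.2 hl)
    rwa [hroot] at this
  obtain ⟨C, t, rfl, ht, hC⟩ :=
    (TermGraph.rep_root_iff.2 (rfl : S.term = _)).exists_context S.var_succ hpu
  obtain rfl := TermGraph.rep_unique ht hul
  refine ⟨⟨l, r⟩, hR, C, σ, rfl, hC, ?_⟩
  have := (hmatch.rep_replaceAt hu' hC hr).same hT
  rw [← hT.2.1] at this
  exact TermGraph.rep_root_iff.1 this

/-- Term rewriting can be carried out by graph rewriting if `p` is unshared, and sharing is maximal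
strictly below `p`. -/
theorem exists_graphRewritesAt [LinearOrder N] [Infinite N] {R : TRS L V}
    {G : Set (GraphRule L V N)} (hG : IsSimulatingGRS R G) {p : List ℕ} {S : TermGraph L V N}
    {t : L.Term V} (hp : S.FunctionAt p → ∃ u, S.pos u = {p}) (hS : ∀ T, ¬ FoldsBelow p S T)
    (hf : S.FunctionAt p) (h : R.RewritesAt p S.term t) :
    ∃ T, GraphRewritesAt G p S T ∧ T.term = t := by
  obtain ⟨⟨l, r⟩, hR, C, σ, rfl, hs, rfl⟩ := h
  obtain ⟨γ, hγ, hsim⟩ := hG.1 _ hR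
  obtain ⟨ρ, hiso, hd, hd'⟩ := γ.exists_isRenaming S
  obtain ⟨⟨hmin, hl⟩, ⟨-, hr⟩, hcom⟩ := hsim.of_isomorphic hiso
  obtain ⟨u, hu⟩ := hp hf
  have hpu : C.holePos ∈ S.pos u := hu ▸ rfl
  obtain ⟨v, hv, hvl⟩ := (TermGraph.rep_root_iff.2 hs).exists_path_holePos
  obtain rfl : v = u := LGraph.Path.unique hv hpu
  obtain ⟨m, hm, hσ⟩ := exists_isMorphism hmin hl ρ.lhs_root_not_var hpu hvl
    fun x y t hx hy hbx hby => eq_of_rep_of_forall_not_foldsBelow hS hx hy hbx hby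
  have hmatch : IsMatch ρ S v m σ :=
    ⟨S.mem_of_pos hpu, hd', fun x hx hx' => hcom ▸ ⟨hx, hx'⟩, hm, hσ⟩
  obtain ⟨T, hT⟩ := hmatch.exists_same
  refine ⟨T, ⟨v, hpu, S.mem_of_pos hpu, γ, hγ, ρ, ⟨hiso, hd, hd'⟩, m, hm, hT⟩, ?_⟩
  have := (hmatch.rep_replaceAt hu hs hr).same hT
  rw [← hT.2.1] at this
  exact TermGraph.rep_root_iff.1 this

theorem TRS.RewritesAt.functionAt {R : TRS L V} {p : List ℕ} {S : TermGraph L V N} {t : L.Term V}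
    (h : R.RewritesAt p S.term t) : S.FunctionAt p := by
  obtain ⟨⟨l, r⟩, hR, C, σ, rfl, hs, -⟩ := h
  obtain ⟨v, hv, hvl⟩ := (TermGraph.rep_root_iff.2 hs).exists_path_holePos
  refine ⟨v, hv, ?_⟩
  cases l with
  | var x => exact absurd rfl (R.lhs_not_var _ hR x)
  | func f ts =>
    obtain ⟨-, hl, -⟩ := LGraph.Rep.func_inv hvl
    exact ⟨_, hl⟩

end TGR

theorem mainTheorem1 {L : FirstOrder.Language} {V N : Type*} [LinearOrder N] [NoMaxOrder N]
    (R : TGR.TRS L V) (G : Set (TGR.GraphRule L V N)) (hG : TGR.IsSimulatingGRS R G)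
    (s t : L.Term V) (S : TGR.TermGraph L V N) (hS : S.term = s) (p : List ℕ) :
    R.RewritesAt p s t ↔
      ∃ U W T : TGR.TermGraph L V N,
        TGR.NormalFormOf (TGR.UnfoldsAbove p) S U ∧
        TGR.NormalFormOf (TGR.FoldsBelow p) U W ∧
        TGR.GraphRewritesAt G p W T ∧ T.term = t := by
  subst hS
  constructor
  · intro h
    have hf := h.functionAt
    obtain ⟨U, hU⟩ := TGR.exists_normalFormOf_unfoldsAbove hf
    obtain ⟨W, hW⟩ := TGR.exists_normalFormOf_foldsBelow p U
    obtain ⟨hterm, hfun, hpos⟩ := hU.unfold_fold hW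
    have : Nonempty N := ⟨S.root⟩
    have : Infinite N := NoMaxOrder.infinite
    obtain ⟨T, hT, e⟩ :=
      TGR.exists_graphRewritesAt hG hpos hW.2 (hfun.1 hf) (t := t) (by rwa [hterm])
    exact ⟨U, W, T, hU, hW, hT, e⟩
  · rintro ⟨U, W, T, hU, hW, hT, rfl⟩
    obtain ⟨hterm, -, hpos⟩ := hU.unfold_fold hW
    rw [← hterm]
    exact TGR.rewritesAt_of_graphRewritesAt hG hpos hT
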